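/- **Setting.** Let $L,M,n$ be natural numbers and let $J=\{1,\dots,N\}$, $N=LM$, be split into $L$ sections of size $M$. Let $P_{(1)},\dots,P_{(L)}>0$ with $\sum_\ell P_{(\ell)}=P$, let $\sigma>0$, and let $\beta\in\mathbb R^N$ be a fixed vector with exactly one nonzero entry in each section, equal to $\sqrt{P_{(\ell)}}$ in section $\ell$. Write $sent=\{j:\beta_j\ne0\}$, $other=J\setminus sent$, $P_j=P_{(\ell)}$ for $j$ in section $\ell$, $\pi_j=P_j/P$, $\nu=P/(P+\sigma^2)$ and $C_{j,R}=n\pi_j\nu$. Let $X=[X_1:\dots:X_N]$ be an $n\times N$ matrix with i.i.d. $N(0,1)$ entries, let $\varepsilon\sim N(0,\sigma^2I_n)$ be independent of $X$, and let $Y=X\beta+\varepsilon$. **Decoder.** Fix real weights $\lambda_{k',k}$ ($1\le k'\le k$) and a threshold $\tau$. Let $G_1=Y$ and $J_1=J$. In step $k\ge1$ put $\mathcal Z_{k,j}=X_j^{T}G_k/\|G_k\|$ for $j\in J$ and $\mathcal Z^{comb}_{k,j}=\sum_{k'=1}^k\lambda_{k',k}\mathcal Z_{k',j}$. The set $dec_k$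 of terms decoded in step $k$ is a subset of $\{j\in J_k:\mathcal Z^{comb}_{k,j}\ge\tau\}$, chosen by any deterministic measurable rule, which may depend on $k$, from the vector $(\mathcal Z^{comb}_{k,j})_{j\in J}$ and the set $dec_1\cup\dots\cup dec_{k-1}$ (for instance all of these terms, or terms in decreasing order of $\mathcal Z^{comb}_{k,j}$ as long as the total weight $\sum_{j\in dec_1\cup\dots\cup dec_k}\pi_j$ is at most a prescribed $q_{1,k}$). Then $J_{k+1}=J\setminus(dec_1\cup\dots\cup dec_k)$, $F_k=\sum_{j\in dec_k}\sqrt{P_j}X_j$, and $G_{k+1}$ is the part of $-F_k$ that is orthogonal to $G_1,\dots,G_k$. Step $k$ is said to be reached if $dec_1,\dots,dec_{k-1}$ are all nonempty. Let $\mathcal F_{k-1}=\sigma(G_1,\dots,G_{k-1},\mathcal Z_1,\dots,\mathcal Z_{k-1})$ with $\mathcal Z_{k'}=(\mathcal Z_{k',j})_{j\in J}$; the sets $dec_1,\dots,dec_{k-1}$ are $\mathcal F_{k-1}$-measurable. Let $\hat q_k=\sum_{j\in sent\cap dec_k}\pi_j$, $\hat f_k=\sum_{j\in other\cap dec_k}\pi_j$,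 $\hat q_k^{adj}=\hat q_k/(1+\hat f_k/\hat q_k)$ (equal to $0$ if $\hat q_k=0$), $\hat q_k^{adj,tot}=\hat q_1^{adj}+\dots+\hat q_k^{adj}$, and $$\hat s_k=\frac1{1-\hat q_{k-1}^{adj,tot}\,\nu},\qquad \hat w_1=\hat s_1=1,\qquad \hat w_k=\hat s_k-\hat s_{k-1}\quad(k\ge2).$$ **Lemma.** Let $2\le k\le n$. Then $1-\hat q_{k-1}^{adj,tot}\nu>0$, $\hat w_k\ge0$ and $\hat w_1+\dots+\hat w_k=\hat s_k$. On the event that step $k$ is reached, the statistics have the representation $$\mathcal Z_{k,j}=\sqrt{\hat w_k\,C_{j,R}}\;\frac{\mathcal X_{d_k}}{\sqrt n}\;1_{\{j\in sent\}}+Z_{k,j}\qquad(j\in J_k),$$ where $$\mathcal X_{d_k}=\frac{\|G_k\|}{\sigma_k},\qquad \sigma_k^2=P\,(\hat q_{k-1}+\hat f_{k-1})\,\frac{\hat s_{k-1}}{\hat s_k}>0,$$ and conditionally on $\mathcal F_{k-1}$, almost surely on this event: $\mathcal X_{d_k}^2$ has the chi-square distribution with $d_k=n-k+1$ degrees of freedom;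 $Z_{k,J_k}=(Z_{k,j})_{j\in J_k}$ has the normal distribution $N_{J_k}(0,\Sigma_k)$ with $\Sigma_k=I-\delta_k\delta_k^{T}/P$ (a positive semidefinite matrix), $\delta_k=\sqrt{\nu_k}\,\beta_{J_k}$, $\nu_k=\hat s_k\nu$; and $\mathcal X_{d_k}^2$ and $Z_{k,J_k}$ are independent. -/

import Mathlib

open MeasureTheory ProbabilityTheory
open scoped NNReal

noncomputable section

namespace SparseSuperposition

/-! ### The code -/

/-- The index set `J` of the columns of the dictionary: `L` sections with `M` terms each. -/
abbrev Term (L M : ℕ) := Fin L × Fin M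

/-- Vectors of `ℝⁿ` with the Euclidean norm. -/
abbrev Vec (n : ℕ) := EuclideanSpace ℝ (Fin n)

/-- The deterministic data of the transmission: the positive powers `P_(ℓ)` of the sections, the
standard deviation `σ > 0` of the noise, and the term that is sent in each section. -/
structure Code (L M : ℕ) where
  power : Fin L → ℝ
  power_pos : ∀ ℓ, 0 < power ℓ
  σ : ℝ≥0
  σ_pos : 0 < σ
  msg : Fin L → Fin M

namespace Code

variable {L M : ℕ} (c : Code L M)

/-- The total power `P`. -/
def P : ℝ := ∑ ℓ, c.power ℓ

/-- `P_j = P_(ℓ)` for `j` in section `ℓ`. -/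
def powerAt (j : Term L M) : ℝ := c.power j.1

/-- The set of the terms that were sent. -/
def sent : Finset (Term L M) := Finset.univ.filter fun j => j.2 = c.msg j.1

/-- The coefficient vector: one nonzero entry `√P_(ℓ)` in each section. -/
def β (j : Term L M) : ℝ := if j ∈ c.sent then √(c.powerAt j) else 0

/-- The weights `π_j = P_j / P`. -/
def π (j : Term L M) : ℝ := c.powerAt j / c.P

/-- `ν = P / (P + σ²)`. -/
def ν : ℝ := c.P / (c.P + (c.σ : ℝ) ^ 2)

/-- `C_{j,R} = n π_j ν`. -/
def C (n : ℕ) (j : Term L M) : ℝ := n * c.π j * c.ν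

end Code

/-! ### The decoder -/

/-- An adaptive successive decoder, given by deterministic weights of combination
`weight k' k = λ_{k',k}`, a threshold `τ`, and the rule by which the terms of step `k` are chosen.
If `D` is the set of the terms decoded before step `k`, and `z` the vector of the combined
statistics of step `k`, then the set `select k D z` of the terms decoded in step `k` consists of
terms outside `D` that are above threshold. -/
structure Decoder (L M : ℕ) where
  weight : ℕ → ℕ → ℝ
  τ : ℝ
  select : ℕ → Finset (Term L M) → (Term L M → ℝ) → Finset (Term L M)
  select_subset : ∀ k D z, ∀ j ∈ select k D z, j ∉ D ∧ τ ≤ z j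
  measurable_select : ∀ k D S, MeasurableSet {z | select k D z = S}

/-- A set-valued map that is given by measurable conditions on the members is measurable. -/
theorem measurableSet_filter_eq {ι α : Type*} [Fintype ι] [MeasurableSpace α]
    (p : α → ι → Prop) [∀ a, DecidablePred (p a)] (hp : ∀ i, MeasurableSet {a | p a i})
    (S : Finset ι) : MeasurableSet {a | Finset.univ.filter (p a) = S} := by
  have h : {a | Finset.univ.filter (p a) = S} = ⋂ i, {a | p a i ↔ i ∈ S} := by
    ext a
    simp [Finset.ext_iff]
  rw [h]
  refine MeasurableSet.iInter fun i => ?_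
  by_cases hi : i ∈ S
  · simpa [hi] using hp i
  · have h2 : {a | p a i ↔ i ∈ S} = {a | p a i}ᶜ := by
      ext a
      simp [hi]
    rw [h2]
    exact (hp i).compl

open Classical in
/-- The decoder that accepts every remaining term above threshold. It stops after step `m`,
or when `L` terms have been decoded. -/
def Decoder.acceptAll (L M m : ℕ) (weight : ℕ → ℕ → ℝ) (τ : ℝ) : Decoder L M where
  weight := weight
  τ := τ
  select k D z := Finset.univ.filter fun j => (k ≤ m ∧ D.card < L) ∧ j ∉ D ∧ τ ≤ z j
  select_subset k D z j hj := (Finset.mem_filter.1 hj).2.2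
  measurable_select k D S := by
    apply measurableSet_filter_eq
    intro j
    have h : MeasurableSet {z : Term L M → ℝ | τ ≤ z j} :=
      measurableSet_le measurable_const (measurable_pi_apply j)
    exact (MeasurableSet.const _).inter ((MeasurableSet.const _).inter h)

/-- `i` comes before `j`, or is `j`, in the order of decreasing values of `z`; ties are broken
by the index. -/
def Precedes {L M : ℕ} (z : Term L M → ℝ) (i j : Term L M) : Prop :=
  z j < z i ∨ (z j = z i ∧ finProdFinEquiv i ≤ finProdFinEquiv j)

open Classical in
/-- The paced decoder: in step `k`, remaining terms above threshold are accepted in decreasing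
order of their combined statistics, as long as the total weight of all decoded terms is at most
`q k`. It stops after step `m`, or when `L` terms have been decoded. -/
def Decoder.paced {L M : ℕ} (c : Code L M) (m : ℕ) (weight : ℕ → ℕ → ℝ) (τ : ℝ) (q : ℕ → ℝ) :
    Decoder L M where
  weight := weight
  τ := τ
  select k D z := Finset.univ.filter fun j => (k ≤ m ∧ D.card < L) ∧ (j ∉ D ∧ τ ≤ z j) ∧
    ∑ i ∈ D, c.π i + ∑ i, (if (i ∉ D ∧ τ ≤ z i) ∧ Precedes z i j then c.π i else 0) ≤ q k
  select_subset k D z j hj := (Finset.mem_filter.1 hj).2.2.1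
  measurable_select k D S := by
    apply measurableSet_filter_eq
    intro j
    have h (i : Term L M) : MeasurableSet {z : Term L M → ℝ | i ∉ D ∧ τ ≤ z i} :=
      (MeasurableSet.const _).inter (measurableSet_le measurable_const (measurable_pi_apply i))
    have hP (i : Term L M) : MeasurableSet {z : Term L M → ℝ | Precedes z i j} :=
      (measurableSet_lt (measurable_pi_apply j) (measurable_pi_apply i)).union
        ((measurableSet_eq_fun (measurable_pi_apply j) (measurable_pi_apply i)).inter
          (MeasurableSet.const _))
    refine (MeasurableSet.const _).inter ((h j).inter ?_)
    have hs : Measurable fun z : Term L M → ℝ =>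
        ∑ i, (if (i ∉ D ∧ τ ≤ z i) ∧ Precedes z i j then c.π i else (0 : ℝ)) :=
      Finset.measurable_sum _ fun i _ =>
        Measurable.ite ((h i).inter (hP i)) measurable_const measurable_const
    exact measurableSet_le (hs.const_add _) measurable_const

/-! ### One run of the decoder -/

/-- The data of one run of the decoder: the code, the decoder, the columns `X_j` of the
dictionary, and the noise vector. -/
structure Trial (L M n : ℕ) where
  code : Code L M
  decoder : Decoder L M
  X : Term L M → Vec n
  ε : Vec n

namespace Trial

variable {L M n : ℕ} (r : Trial L M n)

/-- The received vector `Y = Xβ + ε`. -/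
def Y : Vec n := ∑ j, r.code.β j • r.X j + r.ε

/-- The vectors `Y, -F_1, -F_2, …`, where `F_k = ∑_{j ∈ d k} √P_j X_j` is the fit of step `k`, if
`d k` is the set of the terms decoded in step `k`. -/
def toOrthogonalize (d : ℕ → Finset (Term L M)) : ℕ → Vec n
  | 0 => r.Y
  | k + 1 => -∑ j ∈ d (k + 1), √(r.code.powerAt j) • r.X j

/-- `G_1 = Y`, and `G_k` is the part of `-F_{k-1}` that is orthogonal to `G_1, …, G_{k-1}`. -/
def GOf (d : ℕ → Finset (Term L M)) : ℕ → Vec n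
  | 0 => 0
  | k + 1 => InnerProductSpace.gramSchmidt ℝ (r.toOrthogonalize d) k

/-- `𝒵_{k,j} = X_jᵀ G_k / ‖G_k‖`. -/
def statOf (d : ℕ → Finset (Term L M)) (k : ℕ) (j : Term L M) : ℝ :=
  inner ℝ (r.X j) (r.GOf d k) / ‖r.GOf d k‖

/-- The combined statistic `∑_{k' ≤ k} λ_{k',k} 𝒵_{k',j}`. -/
def combOf (d : ℕ → Finset (Term L M)) (k : ℕ) (j : Term L M) : ℝ :=
  ∑ i ∈ Finset.Icc 1 k, r.decoder.weight i k * r.statOf d i j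

/-- The terms decoded before step `k`. -/
def before (d : ℕ → Finset (Term L M)) (k : ℕ) : Finset (Term L M) :=
  (Finset.Ico 1 k).biUnion d

/-- The sets decoded in the first `k` steps, as a function of the step
(and the empty set for the later steps). -/
def decUpTo : ℕ → ℕ → Finset (Term L M)
  | 0 => fun _ => ∅
  | k + 1 => Function.update (decUpTo k) (k + 1)
      (r.decoder.select (k + 1) (before (decUpTo k) (k + 1)) (r.combOf (decUpTo k) (k + 1)))

/-- The set `dec_k` of the terms decoded in step `k ≥ 1`. -/
def dec (k : ℕ) : Finset (Term L M) := r.decUpTo k k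

/-- The vectors `G_k`, for `k ≥ 1`. -/
def G (k : ℕ) : Vec n := r.GOf r.dec k

/-- The statistics `𝒵_{k,j}`, for `k ≥ 1`. -/
def stat (k : ℕ) (j : Term L M) : ℝ := r.statOf r.dec k j

/-- The combined statistics of step `k ≥ 1`. -/
def comb (k : ℕ) (j : Term L M) : ℝ := r.combOf r.dec k j

/-- The set `J_k` of the terms that were not decoded before step `k`. -/
def J (k : ℕ) : Finset (Term L M) := Finset.univ \ before r.dec k

theorem decUpTo_of_le {i k : ℕ} (h : i ≤ k) : r.decUpTo k i = r.dec i := by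
  induction k, h using Nat.le_induction with
  | base => rfl
  | succ k hk ih => rw [decUpTo, Function.update_of_ne (by omega), ih]

theorem GOf_congr {d e : ℕ → Finset (Term L M)} {k : ℕ} (h : ∀ i, 1 ≤ i → i < k → d i = e i) :
    r.GOf d k = r.GOf e k := by
  have key : ∀ k, (∀ i, 1 ≤ i → i < k + 1 → d i = e i) →
      InnerProductSpace.gramSchmidt ℝ (r.toOrthogonalize d) k =
        InnerProductSpace.gramSchmidt ℝ (r.toOrthogonalize e) k := by
    intro k
    induction k using Nat.strong_induction_on with
    | _ k ih =>
      intro h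
      have hk : r.toOrthogonalize d k = r.toOrthogonalize e k := by
        cases k with
        | zero => rfl
        | succ k => simp only [toOrthogonalize]; rw [h (k + 1) (by omega) (by omega)]
      rw [InnerProductSpace.gramSchmidt_def, InnerProductSpace.gramSchmidt_def, hk]
      congr 1
      refine Finset.sum_congr rfl fun i hi => ?_
      have hi' : i < k := Finset.mem_Iio.1 hi
      rw [ih i hi' fun l h1 h2 => h l h1 (by omega)]
  cases k with
  | zero => rfl
  | succ k => exact key k h

/-- The recursion that determines the run: in step `k` the rule of the decoder is applied to the
set of the terms decoded before and to the combined statistics of step `k`. -/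
theorem dec_eq (k : ℕ) (hk : 1 ≤ k) :
    r.dec k = r.decoder.select k (before r.dec k) (r.comb k) := by
  obtain ⟨k, rfl⟩ : ∃ l, k = l + 1 := ⟨k - 1, by omega⟩
  have hb : before (r.decUpTo k) (k + 1) = before r.dec (k + 1) := by
    refine Finset.biUnion_congr rfl fun i hi => ?_
    exact r.decUpTo_of_le (by have := Finset.mem_Ico.1 hi; omega)
  have hc : r.combOf (r.decUpTo k) (k + 1) = r.comb (k + 1) := by
    funext j
    simp only [comb, combOf]
    refine Finset.sum_congr rfl fun i hi => ?_
    have hG : r.GOf (r.decUpTo k) i = r.GOf r.dec i :=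
      r.GOf_congr fun l _ h2 => r.decUpTo_of_le (by have := Finset.mem_Icc.1 hi; omega)
    simp only [statOf, hG]
  rw [dec, decUpTo, Function.update_self, hb, hc]

/-- Step `k` is reached: something was decoded in every earlier step. -/
def Reached (k : ℕ) : Prop := ∀ i ∈ Finset.Ico 1 k, (r.dec i).Nonempty

/-- What is known before step `k`, that is, `F_{k-1} = (G_1, …, G_{k-1}, 𝒵_1, …, 𝒵_{k-1})`. -/
def past (k : ℕ) : Fin (k - 1) → Vec n × (Term L M → ℝ) :=
  fun i => (r.G (i + 1), r.stat (i + 1))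

/-- `q̂_k`: the weight of the correct detections of step `k`. -/
def qHat (k : ℕ) : ℝ := ∑ j ∈ r.code.sent ∩ r.dec k, r.code.π j

/-- `f̂_k`: the weight of the false alarms of step `k`. -/
def fHat (k : ℕ) : ℝ := ∑ j ∈ r.dec k \ r.code.sent, r.code.π j

/-- `q̂_k^adj = q̂_k / (1 + f̂_k / q̂_k)`; this is `0` if `q̂_k = 0`. -/
def qAdj (k : ℕ) : ℝ := r.qHat k / (1 + r.fHat k / r.qHat k)

/-- `q̂_k^{adj,tot} = q̂_1^adj + ⋯ + q̂_k^adj`. -/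
def qAdjTot (k : ℕ) : ℝ := ∑ i ∈ Finset.Icc 1 k, r.qAdj i

/-- `ŝ_k = 1 / (1 - q̂_{k-1}^{adj,tot} ν)`, for `k ≥ 1`. -/
def sHat (k : ℕ) : ℝ := 1 / (1 - r.qAdjTot (k - 1) * r.code.ν)

/-- The increments of `ŝ`: `ŵ_1 = ŝ_1`, and `ŵ_k = ŝ_k - ŝ_{k-1}` for `k ≥ 2`. -/
def wHat (k : ℕ) : ℝ := if k = 1 then r.sHat 1 else r.sHat k - r.sHat (k - 1)

/-- `ν_k = ŝ_k ν`. -/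
def νAt (k : ℕ) : ℝ := r.sHat k * r.code.ν

/-- `δ_k = √ν_k β_{J_k}`. -/
def δ (k : ℕ) (j : r.J k) : ℝ := √(r.νAt k) * r.code.β j

/-- `Σ_k = I - δ_k δ_kᵀ / P`. -/
def Sig (k : ℕ) : Matrix (r.J k) (r.J k) ℝ :=
  1 - (1 / r.code.P) • Matrix.vecMulVec (r.δ k) (r.δ k)

/-- `σ_k² = P (q̂_{k-1} + f̂_{k-1}) ŝ_{k-1} / ŝ_k`, for `k ≥ 2`. -/
def σSq (k : ℕ) : ℝ :=
  r.code.P * (r.qHat (k - 1) + r.fHat (k - 1)) * (r.sHat (k - 1) / r.sHat k)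

/-- `𝒳_{d_k}`, the nonnegative root of `𝒳_{d_k}² = ‖G_k‖² / σ_k²`. -/
def chi (k : ℕ) : ℝ := √(‖r.G k‖ ^ 2 / r.σSq k)

end Trial

/-- The chi-square distribution with `d` degrees of freedom. -/
def chiSquare (d : ℕ) : Measure ℝ :=
  (Measure.pi fun _ : Fin d => gaussianReal 0 1).map fun x => ∑ i, x i ^ 2

/-- The subvector of `z` with the indices in `S`. -/
def subvector {ι : Type*} (S : Finset ι) (z : ι → ℝ) : EuclideanSpace ℝ S :=
  WithLp.toLp 2 fun j : S => z j

end SparseSuperposition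

end

open SparseSuperposition

/-!
The decoded sets depend on the data, so the coefficients of the `F_i` are random. But there are only
finitely many sequences of decoded sets, and each of them is selected exactly when the past `(G_i,
𝒵_i)_{i < k}` lies in a certain measurable set (`Trial.past_mem_pastSet_iff`). If the sets `d` are
prescribed, this past and the current vector and statistics are the same functions of the data on
that event, and there the conditional distribution given the true past can be read off from an
independence statement for prescribed `d` (`condDistrib_eq_of_indepFun_of_eqOn`,
`condDistrib_of_dec_eq`).

For prescribed `d`, the vectors `Y, -F_1, -F_2, …` and the columns `X_j` are linear combinations
`mix W a` of the columns of a matrix `W` of independent standard normal variables, with constant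
vectors of coefficients `a`. Mixtures with orthogonal coefficients are independent. Let `e` be the
part of the coefficients of the newest vector outside of the span `K` of the earlier ones, `k - 1`
in number. The earlier vectors span a subspace `V` of `ℝⁿ`, almost surely of dimension `k - 1`
(`IsWhite.ae_linearIndepOn`). The Gram–Schmidt vector `G_k` is the projection of `mix W e` onto the
orthogonal complement of `V`, and `mix W e` is independent of the earlier vectors; so, given these,
`‖G_k‖² / ‖e‖²` is chi-square with `n - k + 1` degrees of freedom. Split the coefficients of a
column into a part in `K`, which contributes nothing to `X_jᵀ G_k`, a component along `e`, which
contributes a multiple of `‖G_k‖`, and a rest `h_j`, whose mixture is independent of `mix W e`.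
Along the unit vector `G_k / ‖G_k‖` the mixtures of the `h_j` are jointly normal, whatever this
vector is, with the Gram matrix of the `h_j` as covariance. Finally, the earlier statistics are
functions of the earlier vectors and of components along vectors in `V`, and these components are
independent of those along the complement of `V`. This is `IsWhite.step`.

It remains to compute with coefficients. The vectors of the `F_i` are orthogonal to each other, as
the decoded sets are disjoint, and the part of the coefficients of `Y` outside of their span has
squared norm `(P + σ²) / ŝ`. This gives `‖e‖² = σ_k²` (`Trial.norm_innovation_sq`), the Gram matrix
`Σ_k` (`Trial.gram_eq_Sig`), and the shift of the statistics of the sent terms (`Trial.shift_eq`).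
-/

noncomputable section

namespace SparseSuperposition

/-! ### Independence and conditional distributions -/

section Independence

variable {Ω α β γ δ : Type*} [MeasurableSpace Ω] [MeasurableSpace α] [MeasurableSpace β]
  [MeasurableSpace γ] [MeasurableSpace δ] {μ : Measure Ω} [IsProbabilityMeasure μ]

/-- For independent `X` and `Y`: if for almost every value `x` of `X` the variables `Φ (x, Y)` and
`Ψ (x, Y)` are independent, and the law `ρ` of `Ψ (x, Y)` does not depend on `x`, then `Ψ (X, Y)`
has the law `ρ` and is independent of the pair `(X, Φ (X, Y))`. -/
theorem indepFun_of_fiberwise {X : Ω → α} {Y : Ω → β} (hX : Measurable X) (hY : Measurable Y)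
    (hXY : IndepFun X Y μ) {Φ : α × β → γ} {Ψ : α × β → δ} (hΦ : Measurable Φ)
    (hΨ : Measurable Ψ) (ρ : Measure δ)
    (h : ∀ᵐ ω ∂μ, IndepFun (fun ω' => Φ (X ω, Y ω')) (fun ω' => Ψ (X ω, Y ω')) μ ∧
      μ.map (fun ω' => Ψ (X ω, Y ω')) = ρ) :
    IndepFun (fun ω => (X ω, Φ (X ω, Y ω))) (fun ω => Ψ (X ω, Y ω)) μ ∧
      μ.map (fun ω => Ψ (X ω, Y ω)) = ρ := by
  have key : ∀ B : Set (α × γ), MeasurableSet B → ∀ E : Set δ, MeasurableSet E →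
      μ ((fun ω => (X ω, Φ (X ω, Y ω))) ⁻¹' B ∩ (fun ω => Ψ (X ω, Y ω)) ⁻¹' E) =
        μ ((fun ω => (X ω, Φ (X ω, Y ω))) ⁻¹' B) * ρ E := by
    intro B hB E hE
    have hB' : MeasurableSet {p : α × β | (p.1, Φ p) ∈ B} :=
      (measurable_fst.prodMk hΦ) hB
    have hE' : MeasurableSet {p : α × β | Ψ p ∈ E} := hΨ hE
    have hlaw := (indepFun_iff_map_prod_eq_prod_map_map hX.aemeasurable hY.aemeasurable).1 hXY
    have e (S : Set (α × β)) (hS : MeasurableSet S) :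
        μ ((fun ω => (X ω, Y ω)) ⁻¹' S) =
          ∫⁻ ω, μ ((fun ω' => (X ω, Y ω')) ⁻¹' S) ∂μ := by
      have : IsProbabilityMeasure (μ.map Y) := Measure.isProbabilityMeasure_map hY.aemeasurable
      rw [← Measure.map_apply (hX.prodMk hY) hS, hlaw, Measure.prod_apply hS,
        lintegral_map (measurable_measure_prodMk_left hS) hX]
      refine lintegral_congr fun ω => ?_
      rw [Measure.map_apply hY (measurable_prodMk_left hS)]
      rfl
    have e1 := e _ (hB'.inter hE')
    have e2 := e _ hB'
    calc _ = ∫⁻ ω, μ ((fun ω' => (X ω, Y ω')) ⁻¹'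
          ({p : α × β | (p.1, Φ p) ∈ B} ∩ {p : α × β | Ψ p ∈ E})) ∂μ := e1
      _ = ∫⁻ ω, μ ((fun ω' => (X ω, Y ω')) ⁻¹' {p : α × β | (p.1, Φ p) ∈ B}) * ρ E ∂μ := by
          refine lintegral_congr_ae ?_
          filter_upwards [h] with ω hω
          have h1 := hω.1.measure_inter_preimage_eq_mul (Prod.mk (X ω) ⁻¹' B) E
            (measurable_prodMk_left hB) hE
          have hm : Measurable fun ω' => Ψ (X ω, Y ω') := hΨ.comp (measurable_const.prodMk hY)
          rw [← hω.2, Measure.map_apply hm hE]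
          exact h1
      _ = _ := by
          have hm : Measurable fun ω =>
              μ ((fun ω' => (X ω, Y ω')) ⁻¹' {p : α × β | (p.1, Φ p) ∈ B}) := by
            have := (measurable_measure_prodMk_left (ν := μ.map Y) hB').comp hX
            convert this using 1
            ext ω
            simp only [Function.comp]
            rw [Measure.map_apply hY (measurable_prodMk_left hB')]
            rfl
          rw [lintegral_mul_const _ hm]
          congr 1
          exact e2.symm
  have hm : Measurable fun ω => Ψ (X ω, Y ω) := hΨ.comp (hX.prodMk hY)
  have hlaw : μ.map (fun ω => Ψ (X ω, Y ω)) = ρ := by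
    ext E hE
    have := key Set.univ MeasurableSet.univ E hE
    rw [Measure.map_apply hm hE]
    simpa using this
  refine ⟨?_, hlaw⟩
  rw [indepFun_iff_measure_inter_preimage_eq_mul]
  intro B E hB hE
  rw [key B hB E hE, ← hlaw, Measure.map_apply hm hE]

/-- If `X = X'` and `Y = Y'` on an event that is determined by the value of `X`, and equally by that
of `X'`, and `X'` and `Y'` are independent, then on this event the conditional distribution of `Y`
given `X` is the unconditional distribution of `Y'`. -/
theorem condDistrib_eq_of_indepFun_of_eqOn [StandardBorelSpace δ] [Nonempty δ]
    {X X' : Ω → α} {Y Y' : Ω → δ} (hX : Measurable X) (hY : Measurable Y)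
    (hY'm : Measurable Y')
    {B : Set α} (hB : MeasurableSet B) (hBB : ∀ ω, X' ω ∈ B ↔ X ω ∈ B)
    (hXX : ∀ ω, X ω ∈ B → X' ω = X ω) (hYY : ∀ ω, X ω ∈ B → Y' ω = Y ω)
    (hind : IndepFun X' Y' μ) :
    ∀ᵐ ω ∂μ, X ω ∈ B → condDistrib Y X μ (X ω) = μ.map Y' := by
  classical
  have : IsProbabilityMeasure (μ.map Y') := Measure.isProbabilityMeasure_map hY'm.aemeasurable
  -- a version of the conditional distribution that is constant on `B`
  have hκ : μ.map (fun ω => (X ω, Y ω)) = μ.map X ⊗ₘ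
      Kernel.piecewise hB (Kernel.const α (μ.map Y')) (condDistrib Y X μ) := by
    have : IsProbabilityMeasure (μ.map X) := Measure.isProbabilityMeasure_map hX.aemeasurable
    have : IsProbabilityMeasure (μ.map fun ω => (X ω, Y ω)) :=
      Measure.isProbabilityMeasure_map (hX.prodMk hY).aemeasurable
    refine Measure.ext_prod (fun {s t} hs ht => ?_)
    rw [Measure.compProd_apply_prod hs ht, Measure.map_apply (hX.prodMk hY) (hs.prod ht),
      ← lintegral_inter_add_sdiff _ s hB]
    have h1 : ∫⁻ a in s ∩ B, Kernel.piecewise hB (Kernel.const α (μ.map Y'))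
        (condDistrib Y X μ) a t ∂μ.map X = μ (X ⁻¹' (s ∩ B) ∩ Y ⁻¹' t) := by
      rw [setLIntegral_congr_fun (g := fun _ => μ.map Y' t) (hs.inter hB)
        (fun a ha => by simp [Kernel.piecewise_apply, ha.2])]
      rw [setLIntegral_const, Measure.map_apply hX (hs.inter hB), Measure.map_apply hY'm ht,
        mul_comm]
      have e1 : X ⁻¹' (s ∩ B) = X' ⁻¹' (s ∩ B) := by
        ext ω
        simp only [Set.mem_preimage, Set.mem_inter_iff, hBB]
        refine and_congr_left fun hω => ?_
        rw [hXX ω hω]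
      have e2 : X ⁻¹' (s ∩ B) ∩ Y ⁻¹' t = X' ⁻¹' (s ∩ B) ∩ Y' ⁻¹' t := by
        rw [← e1]
        ext ω
        simp only [Set.mem_preimage, Set.mem_inter_iff]
        refine and_congr_right fun hω => ?_
        rw [hYY ω hω.2]
      rw [e2, hind.measure_inter_preimage_eq_mul _ _ (hs.inter hB) ht, e1]
    have h2 : ∫⁻ a in s \ B, Kernel.piecewise hB (Kernel.const α (μ.map Y'))
        (condDistrib Y X μ) a t ∂μ.map X = μ (X ⁻¹' (s \ B) ∩ Y ⁻¹' t) := by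
      rw [setLIntegral_congr_fun (g := fun a => condDistrib Y X μ a t) (hs.diff hB)
        (fun a ha => by simp [Kernel.piecewise_apply, ha.2])]
      rw [setLIntegral_map (hs.diff hB) (Kernel.measurable_coe _ ht) hX]
      exact setLIntegral_preimage_condDistrib hX hY.aemeasurable ht (hs.diff hB)
    rw [h1, h2, ← measure_inter_add_sdiff ((fun ω => (X ω, Y ω)) ⁻¹' s ×ˢ t) (hX hB)]
    congr 2 <;> ext ω <;> simp <;> tauto
  have := condDistrib_ae_eq_of_measure_eq_compProd X hY.aemeasurable hκ
  filter_upwards [ae_of_ae_map hX.aemeasurable this] with ω hω hωB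
  rw [hω]
  simp [Kernel.piecewise_apply, hωB]

end Independence

/-! ### White noise -/

section WhiteNoise

variable {Ω ι : Type*} [MeasurableSpace Ω] [Fintype ι] {n : ℕ} {μ : Measure Ω}

/-- The linear combination `∑ i, a_i w_i` of the columns of `w`, as a linear map in the vector `a`
of the coefficients. -/
def mix (w : ι → Vec n) : EuclideanSpace ℝ ι →ₗ[ℝ] Vec n where
  toFun a := ∑ i, a i • w i
  map_add' a b := by simp [add_smul, Finset.sum_add_distrib]
  map_smul' c a := by simp [mul_smul, Finset.smul_sum]

theorem mix_apply (w : ι → Vec n) (a : EuclideanSpace ℝ ι) : mix w a = ∑ i, a i • w i := rfl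

/-- The family of all entries of the matrix with columns `w i`, as one Euclidean vector. -/
def entries (w : ι → Vec n) : EuclideanSpace ℝ (ι × Fin n) := WithLp.toLp 2 fun p => w p.1 p.2

/-- The elementary tensor `a ⊗ x`. -/
def tensor (a : EuclideanSpace ℝ ι) (x : Vec n) : EuclideanSpace ℝ (ι × Fin n) :=
  WithLp.toLp 2 fun p => a p.1 * x p.2

theorem inner_tensor_tensor (a b : EuclideanSpace ℝ ι) (x y : Vec n) :
    inner ℝ (tensor a x) (tensor b y) = inner ℝ a b * inner ℝ x y := by
  simp only [tensor, PiLp.inner_apply, Fintype.sum_prod_type, Finset.sum_mul_sum,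
    RCLike.inner_apply, conj_trivial]
  refine Finset.sum_congr rfl fun i _ => Finset.sum_congr rfl fun j _ => ?_
  ring

/-- Inner products of mixed columns with fixed vectors are linear functionals of the entries. -/
theorem inner_mix (w : ι → Vec n) (a : EuclideanSpace ℝ ι) (x : Vec n) :
    inner ℝ (mix w a) x = inner ℝ (tensor a x) (entries w) := by
  simp only [mix_apply, sum_inner, tensor, entries, PiLp.inner_apply, PiLp.smul_apply,
    smul_eq_mul, Fintype.sum_prod_type, RCLike.inner_apply, conj_trivial]
  refine Finset.sum_congr rfl fun i _ => Finset.sum_congr rfl fun j _ => ?_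
  ring

/-- The entries of the random matrix `W` are independent standard normal variables. -/
structure IsWhite (W : Ω → ι → Vec n) (μ : Measure Ω) : Prop where
  measurable : Measurable W
  map_entries : μ.map (fun ω => entries (W ω)) = stdGaussian (EuclideanSpace ℝ (ι × Fin n))

theorem measurable_mix {W : Ω → ι → Vec n} (h : Measurable W) (a : EuclideanSpace ℝ ι) :
    Measurable fun ω => mix (W ω) a := by
  have : ∀ i, Measurable fun ω => W ω i := fun i => (measurable_pi_apply i).comp h
  simp only [mix_apply]
  fun_prop

omit [Fintype ι] in
theorem measurable_entries {W : Ω → ι → Vec n} (h : Measurable W) :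
    Measurable fun ω => entries (W ω) := by
  have : ∀ p : ι × Fin n, Measurable fun ω => W ω p.1 p.2 := fun p => by
    have := (measurable_pi_apply p.1).comp h
    fun_prop
  unfold entries
  fun_prop

theorem measurable_columns (κ : Type*) : Measurable fun (f : κ × Fin n → ℝ) (i : κ) =>
    (WithLp.toLp 2 fun p => f (i, p) : Vec n) := by
  refine measurable_pi_lambda _ fun i => ?_
  fun_prop

namespace IsWhite

variable {W : Ω → ι → Vec n}

section

variable (hW : IsWhite W μ)
include hW

theorem hasGaussianLaw_entries : HasGaussianLaw (fun ω => entries (W ω)) μ where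
  isGaussian_map := by rw [hW.map_entries]; infer_instance

theorem isProbabilityMeasure : IsProbabilityMeasure μ :=
  hW.hasGaussianLaw_entries.isProbabilityMeasure

theorem integral_inner (a : EuclideanSpace ℝ ι) (x : Vec n) :
    ∫ ω, inner ℝ (mix (W ω) a) x ∂μ = 0 := by
  simp only [inner_mix]
  have h := integral_strongDual_stdGaussian (E := EuclideanSpace ℝ (ι × Fin n))
    (innerSL ℝ (tensor a x))
  rw [← hW.map_entries, integral_map (measurable_entries hW.measurable).aemeasurable
    (by fun_prop)] at h
  simpa using h

theorem covariance_inner (a b : EuclideanSpace ℝ ι) (x y : Vec n) :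
    cov[fun ω => inner ℝ (mix (W ω) a) x, fun ω => inner ℝ (mix (W ω) b) y; μ] =
      inner ℝ a b * inner ℝ x y := by
  simp only [inner_mix]
  rw [← inner_tensor_tensor]
  have h := covarianceBilin_apply_eq_cov (μ := stdGaussian (EuclideanSpace ℝ (ι × Fin n)))
    IsGaussian.memLp_two_id (tensor a x) (tensor b y)
  rw [covarianceBilin_stdGaussian, ← hW.map_entries,
    covariance_map (by fun_prop) (by fun_prop)
      (measurable_entries hW.measurable).aemeasurable] at h
  exact h.symm

theorem hasGaussianLaw_inner {κ : Type*} [Finite κ] (a : κ → EuclideanSpace ℝ ι) (x : κ → Vec n) :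
    HasGaussianLaw (fun ω i => inner ℝ (mix (W ω) (a i)) (x i)) μ := by
  simp only [inner_mix]
  have := Fintype.ofFinite κ
  exact hW.hasGaussianLaw_entries.map_fun
    (ContinuousLinearMap.pi fun i => innerSL ℝ (tensor (a i) (x i)))

theorem indepFun_inner {κ κ' : Type*} [Finite κ] [Finite κ'] (a : κ → EuclideanSpace ℝ ι)
    (x : κ → Vec n) (b : κ' → EuclideanSpace ℝ ι) (y : κ' → Vec n)
    (h : ∀ i j, (inner ℝ (a i) (b j) : ℝ) = 0 ∨ (inner ℝ (x i) (y j) : ℝ) = 0) :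
    IndepFun (fun ω i => (inner ℝ (mix (W ω) (a i)) (x i) : ℝ))
      (fun ω j => (inner ℝ (mix (W ω) (b j)) (y j) : ℝ)) μ := by
  have := Fintype.ofFinite κ
  have := Fintype.ofFinite κ'
  refine HasGaussianLaw.indepFun_of_covariance_eval
    (X := fun i ω => inner ℝ (mix (W ω) (a i)) (x i))
    (Y := fun j ω => inner ℝ (mix (W ω) (b j)) (y j)) ?_ ?_
  · simp only [inner_mix]
    exact hW.hasGaussianLaw_entries.map_fun
      ((ContinuousLinearMap.pi fun i => innerSL ℝ (tensor (a i) (x i))).prod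
        (ContinuousLinearMap.pi fun i => innerSL ℝ (tensor (b i) (y i))))
  · intro i j
    rw [hW.covariance_inner]
    rcases h i j with h | h <;> simp [h]

theorem indepFun_mix {κ κ' : Type*} [Finite κ] [Finite κ'] (a : κ → EuclideanSpace ℝ ι)
    (b : κ' → EuclideanSpace ℝ ι) (h : ∀ i j, (inner ℝ (a i) (b j) : ℝ) = 0) :
    IndepFun (fun ω i => mix (W ω) (a i)) (fun ω j => mix (W ω) (b j)) μ := by
  have key := hW.indepFun_inner (κ := κ × Fin n) (κ' := κ' × Fin n)
    (fun p => a p.1) (fun p => EuclideanSpace.basisFun _ ℝ p.2)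
    (fun p => b p.1) (fun p => EuclideanSpace.basisFun _ ℝ p.2) (fun i j => Or.inl (h _ _))
  have := key.comp (measurable_columns κ) (measurable_columns κ')
  convert this using 1 <;>
  · ext ω i p
    simp [EuclideanSpace.inner_single_right]

/-- The components of mixed columns along a fixed unit vector are jointly normal; their covariance
matrix is the Gram matrix of the mixing coefficients. -/
theorem map_inner_unit {κ : Type*} [Fintype κ] [DecidableEq κ] (h : κ → EuclideanSpace ℝ ι)
    {v : Vec n} (hv : ‖v‖ = 1) :
    μ.map (fun ω => (WithLp.toLp 2 fun j => (inner ℝ (mix (W ω) (h j)) v : ℝ) :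
      EuclideanSpace ℝ κ)) =
      multivariateGaussian 0 (Matrix.gram ℝ h) := by
  have hG : HasGaussianLaw (fun ω => (WithLp.toLp 2 fun j => (inner ℝ (mix (W ω) (h j)) v : ℝ) :
      EuclideanSpace ℝ κ)) μ :=
    (hW.hasGaussianLaw_inner h fun _ => v).map_equiv_fun
      (PiLp.continuousLinearEquiv 2 ℝ (fun _ : κ => ℝ)).symm
  have := hW.isProbabilityMeasure
  have := hG.isGaussian_map
  refine Measure.ext_of_charFun ?_
  ext t
  have e : (fun ω => (inner ℝ t (WithLp.toLp 2 fun j => (inner ℝ (mix (W ω) (h j)) v : ℝ) :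
      EuclideanSpace ℝ κ) : ℝ)) = fun ω => inner ℝ (mix (W ω) (∑ j, t j • h j)) v := by
    ext ω
    rw [PiLp.inner_apply]
    simp [sum_inner, real_inner_smul_left, map_sum, mul_comm]
  rw [hG.charFun_map_eq, e, hW.integral_inner, ← covariance_self, hW.covariance_inner,
    charFun_multivariateGaussian (Matrix.posSemidef_gram ℝ h)]
  · have hq : (inner ℝ (∑ j, t j • h j) (∑ j, t j • h j) : ℝ) =
        t ⬝ᵥ (Matrix.gram ℝ h).mulVec t := by
      simp only [Matrix.gram, dotProduct, Matrix.mulVec, sum_inner, inner_sum,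
        real_inner_smul_left, real_inner_smul_right, Finset.mul_sum, Matrix.of_apply]
      rw [Finset.sum_comm]
      refine Finset.sum_congr rfl fun i _ => Finset.sum_congr rfl fun j _ => ?_
      rw [real_inner_comm]
      ring
    rw [hq, real_inner_self_eq_norm_sq v, hv]
    simp
  · exact (Measurable.inner (measurable_mix hW.measurable _) measurable_const).aemeasurable

theorem map_inner_orthonormal {κ : Type*} [Fintype κ] {e : EuclideanSpace ℝ ι} (he : ‖e‖ = 1)
    {b : κ → Vec n} (hb : Orthonormal ℝ b) :
    μ.map (fun ω i => (inner ℝ (mix (W ω) e) (b i) : ℝ)) =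
      Measure.pi fun _ => gaussianReal 0 1 := by
  classical
  have := hW.isProbabilityMeasure
  have hm (i : κ) : Measurable fun ω => (inner ℝ (mix (W ω) e) (b i) : ℝ) :=
    Measurable.inner (measurable_mix hW.measurable _) measurable_const
  have hG := hW.hasGaussianLaw_inner (fun _ => e) b
  have hind : iIndepFun (fun i ω => (inner ℝ (mix (W ω) e) (b i) : ℝ)) μ := by
    refine hG.iIndepFun_of_covariance_eq_zero fun i j hij => ?_
    rw [hW.covariance_inner, hb.2 hij, mul_zero]
  rw [(iIndepFun_iff_map_fun_eq_pi_map fun i => (hm i).aemeasurable).1 hind]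
  congr 1
  ext1 i
  rw [HasGaussianLaw.map_eq_gaussianReal (hG.eval i), hW.integral_inner,
    ← covariance_self (hm i).aemeasurable, hW.covariance_inner, real_inner_self_eq_norm_sq,
    real_inner_self_eq_norm_sq, he, hb.1 i]
  simp

theorem ae_inner_ne_zero {e : EuclideanSpace ℝ ι} (he : e ≠ 0) {v : Vec n} (hv : v ≠ 0) :
    ∀ᵐ ω ∂μ, (inner ℝ (mix (W ω) e) v : ℝ) ≠ 0 := by
  have := hW.isProbabilityMeasure
  have hm : Measurable fun ω => (inner ℝ (mix (W ω) e) v : ℝ) :=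
    Measurable.inner (measurable_mix hW.measurable _) measurable_const
  have hG := (hW.hasGaussianLaw_inner (fun _ : Unit => e) (fun _ => v)).eval ()
  have hpos : 0 < ‖e‖ ^ 2 * ‖v‖ ^ 2 := by positivity
  have h1 : μ.map (fun ω => (inner ℝ (mix (W ω) e) v : ℝ)) =
      gaussianReal 0 (‖e‖ ^ 2 * ‖v‖ ^ 2).toNNReal := by
    rw [HasGaussianLaw.map_eq_gaussianReal hG, hW.integral_inner,
      ← covariance_self hm.aemeasurable, hW.covariance_inner, real_inner_self_eq_norm_sq,
      real_inner_self_eq_norm_sq]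
  have : NullSingletonClass (μ.map (fun ω => (inner ℝ (mix (W ω) e) v : ℝ))) := by
    rw [h1]
    exact nullSingletonClass_gaussianReal (by simpa using hpos)
  refine ae_of_ae_map (p := fun x => x ≠ 0) hm.aemeasurable ?_
  simp [ae_iff]

end

end IsWhite

end WhiteNoise

/-! ### Gram–Schmidt residuals -/

section GramSchmidt

open Submodule InnerProductSpace

variable {E : Type*} [NormedAddCommGroup E] [InnerProductSpace ℝ E] [FiniteDimensional ℝ E]

/-- A vector of the Gram–Schmidt process is the part of the original vector outside of the span of
the original vectors before it. This holds without linear independence. -/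
theorem gramSchmidt_eq_starProjection (f : ℕ → E) (m : ℕ) :
    gramSchmidt ℝ f m = (span ℝ (f '' Set.Iio m))ᗮ.starProjection (f m) := by
  have hmem : gramSchmidt ℝ f m ∈ (span ℝ (f '' Set.Iio m))ᗮ := by
    rw [← span_gramSchmidt_Iio, mem_orthogonal]
    intro u hu
    induction hu using span_induction with
    | mem x hx =>
      obtain ⟨i, hi, rfl⟩ := hx
      exact gramSchmidt_orthogonal ℝ f (ne_of_lt hi)
    | zero => simp
    | add x y _ _ hx hy => rw [inner_add_left, hx, hy, add_zero]
    | smul c x _ hx => rw [real_inner_smul_left, hx, mul_zero]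
  symm
  refine eq_starProjection_of_mem_orthogonal hmem ?_
  rw [orthogonal_orthogonal, ← span_gramSchmidt_Iio, gramSchmidt_def, sub_sub_cancel]
  refine sum_mem fun i hi => ?_
  rw [starProjection_singleton]
  exact smul_mem _ _ (subset_span ⟨i, by simpa using hi, rfl⟩)

omit [FiniteDimensional ℝ E] in
theorem gramSchmidt_congr {f g : ℕ → E} {m : ℕ} (h : ∀ i ≤ m, f i = g i) :
    gramSchmidt ℝ f m = gramSchmidt ℝ g m := by
  induction m using Nat.strong_induction_on with
  | _ m ih =>
    rw [gramSchmidt_def, gramSchmidt_def, h m le_rfl]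
    congr 1
    refine Finset.sum_congr rfl fun i hi => ?_
    have hi' : i < m := Finset.mem_Iio.1 hi
    rw [ih i hi' fun j hj => h j (hj.trans hi'.le)]

theorem measurable_gramSchmidt {α : Type*} [MeasurableSpace α] {n : ℕ} {f : α → ℕ → Vec n}
    (hf : ∀ i, Measurable fun x => f x i) (m : ℕ) :
    Measurable fun x => gramSchmidt ℝ (f x) m := by
  induction m using Nat.strong_induction_on with
  | _ m ih =>
    have h : (fun x => gramSchmidt ℝ (f x) m) = fun x => f x m - ∑ i ∈ Finset.Iio m,
        (inner ℝ (gramSchmidt ℝ (f x) i) (f x m) / ‖gramSchmidt ℝ (f x) i‖ ^ 2) •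
          gramSchmidt ℝ (f x) i := by
      ext1 x
      rw [gramSchmidt_def]
      simp only [starProjection_singleton]
      rfl
    rw [h]
    refine (hf m).sub (Finset.measurable_sum _ fun i hi => ?_)
    have hi' := ih i (Finset.mem_Iio.1 hi)
    exact ((hi'.inner (hf m)).div (hi'.norm.pow_const 2)).smul hi'

/-- The sequence `v 0, …, v (m - 1), u, u, …`. -/
def snocSeq {m : ℕ} (v : Fin m → E) (u : E) (i : ℕ) : E := if h : i < m then v ⟨i, h⟩ else u

omit [NormedAddCommGroup E] [InnerProductSpace ℝ E] [FiniteDimensional ℝ E] in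
theorem image_snocSeq {m : ℕ} (v : Fin m → E) (u : E) :
    snocSeq v u '' Set.Iio m = Set.range v := by
  ext x
  constructor
  · rintro ⟨i, hi, rfl⟩
    exact ⟨⟨i, hi⟩, by simp [snocSeq, Set.mem_Iio.1 hi]⟩
  · rintro ⟨i, rfl⟩
    exact ⟨i, i.2, by simp [snocSeq]⟩

omit [NormedAddCommGroup E] [InnerProductSpace ℝ E] [FiniteDimensional ℝ E] in
theorem image_Iio_eq_range (f : ℕ → E) (m : ℕ) :
    f '' Set.Iio m = Set.range fun i : Fin m => f i := by
  ext x
  constructor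
  · rintro ⟨i, hi, rfl⟩
    exact ⟨⟨i, hi⟩, rfl⟩
  · rintro ⟨i, rfl⟩
    exact ⟨i, i.2, rfl⟩

theorem gramSchmidt_snocSeq {m : ℕ} (v : Fin m → E) (u : E) :
    gramSchmidt ℝ (snocSeq v u) m = (span ℝ (Set.range v))ᗮ.starProjection u := by
  rw [gramSchmidt_eq_starProjection, image_snocSeq]
  simp [snocSeq]

theorem measurable_gramSchmidt_snocSeq {α : Type*} [MeasurableSpace α] {n m : ℕ}
    {v : α → Fin m → Vec n} {u : α → Vec n} (hv : Measurable v) (hu : Measurable u) (i : ℕ) :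
    Measurable fun x => gramSchmidt ℝ (snocSeq (v x) (u x)) i := by
  refine measurable_gramSchmidt (fun i => ?_) i
  by_cases h : i < m
  · simp only [snocSeq, h, dite_true]
    exact (measurable_pi_apply _).comp hv
  · simpa [snocSeq, h] using hu

end GramSchmidt

/-! ### The law of one step -/

section Step

open Submodule InnerProductSpace

variable {Ω ι : Type*} [MeasurableSpace Ω] [Fintype ι] {n : ℕ} {μ : Measure Ω}
  {W : Ω → ι → Vec n}

theorem ae_of_indepFun {α β : Type*} [MeasurableSpace α] [MeasurableSpace β]
    [IsProbabilityMeasure μ] {X : Ω → α} {Y : Ω → β} (hX : Measurable X) (hY : Measurable Y)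
    (hXY : IndepFun X Y μ) {p : α × β → Prop} (hp : MeasurableSet {x | p x})
    (h : ∀ᵐ ω ∂μ, ∀ᵐ ω' ∂μ, p (X ω, Y ω')) : ∀ᵐ ω ∂μ, p (X ω, Y ω) := by
  have : IsProbabilityMeasure (μ.map X) := Measure.isProbabilityMeasure_map hX.aemeasurable
  have : IsProbabilityMeasure (μ.map Y) := Measure.isProbabilityMeasure_map hY.aemeasurable
  have hlaw := (indepFun_iff_map_prod_eq_prod_map_map hX.aemeasurable hY.aemeasurable).1 hXY
  refine ae_of_ae_map (p := p) (hX.prodMk hY).aemeasurable ?_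
  rw [hlaw]
  rw [Measure.ae_prod_iff_ae_ae hp]
  have hm : MeasurableSet {x | ∀ᵐ y ∂μ.map Y, p (x, y)} :=
    measurable_measure_prodMk_left (ν := μ.map Y) hp.compl (measurableSet_singleton 0)
  rw [ae_map_iff hX.aemeasurable hm]
  filter_upwards [h] with ω hω
  exact (ae_map_iff (p := fun y => p (X ω, y)) hY.aemeasurable (measurable_prodMk_left hp)).2 hω

theorem mix_mem_span (w : ι → Vec n) (a : ℕ → EuclideanSpace ℝ ι) (s : Set ℕ)
    {b : EuclideanSpace ℝ ι} (hb : b ∈ span ℝ (a '' s)) :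
    mix w b ∈ span ℝ ((fun i => mix w (a i)) '' s) := by
  have := mem_map_of_mem (f := mix w) hb
  rw [map_span, ← Set.image_comp] at this
  exact this

/-- Mixtures with coefficients orthogonal to those of the past are independent of the past. -/
theorem IsWhite.indepFun_past (hW : IsWhite W μ) (a : ℕ → EuclideanSpace ℝ ι) (m : ℕ)
    {κ : Type*} [Finite κ] (b : κ → EuclideanSpace ℝ ι)
    (hb : ∀ j, b j ∈ (span ℝ (a '' Set.Iio m))ᗮ) :
    IndepFun (fun ω (i : Fin m) => mix (W ω) (a i)) (fun ω j => mix (W ω) (b j)) μ :=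
  hW.indepFun_mix (fun i : Fin m => a i) b fun i j =>
    (mem_orthogonal _ _).1 (hb j) _ (subset_span ⟨i, i.2, rfl⟩)

/-- Mixtures of white noise with at most `n` linearly independent vectors of coefficients are almost
surely linearly independent: the newest one has a component that is independent of the others, and
normal along a direction orthogonal to their span. -/
theorem IsWhite.ae_linearIndepOn (hW : IsWhite W μ) (a : ℕ → EuclideanSpace ℝ ι) (m : ℕ)
    (hm : m ≤ n) (ha : LinearIndepOn ℝ a (Set.Iio m)) :
    ∀ᵐ ω ∂μ, LinearIndepOn ℝ (fun i => mix (W ω) (a i)) (Set.Iio m) := by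
  have := hW.isProbabilityMeasure
  induction m with
  | zero => simp
  | succ m ih =>
    have hI : Set.Iio (m + 1) = insert m (Set.Iio m) := by
      ext i
      simp only [Set.mem_Iio, Set.mem_insert_iff]
      omega
    rw [hI] at ha ⊢
    obtain ⟨ha1, ha2⟩ := (linearIndepOn_insert (by simp)).1 ha
    set K := span ℝ (a '' Set.Iio m) with hK
    set e := Kᗮ.starProjection (a m) with he
    have he0 : e ≠ 0 := by
      intro h
      rw [he, starProjection_apply_eq_zero_iff, orthogonal_orthogonal] at h
      exact ha2 h
    have hmV : Measurable fun ω (i : Fin m) => mix (W ω) (a i) :=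
      measurable_pi_lambda _ fun i => measurable_mix hW.measurable _
    have hmU : Measurable fun ω (_ : Unit) => mix (W ω) e :=
      measurable_pi_lambda _ fun i => measurable_mix hW.measurable _
    have key : ∀ᵐ ω ∂μ,
        gramSchmidt ℝ (snocSeq (fun i : Fin m => mix (W ω) (a i)) (mix (W ω) e)) m ≠ 0 := by
      refine ae_of_indepFun (p := fun x => gramSchmidt ℝ (snocSeq x.1 (x.2 ())) m ≠ 0) hmV hmU
        (hW.indepFun_past a m (fun _ : Unit => e) fun _ => starProjection_apply_mem _ _) ?_ ?_
      · have h1 : Measurable fun x : (Fin m → Vec n) × (Unit → Vec n) =>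
            gramSchmidt ℝ (snocSeq x.1 (x.2 ())) m :=
          measurable_gramSchmidt_snocSeq measurable_fst
            ((measurable_pi_apply ()).comp measurable_snd) m
        exact (h1 (measurableSet_singleton 0)).compl
      · refine Filter.Eventually.of_forall fun ω => ?_
        set v : Fin m → Vec n := fun i => mix (W ω) (a i)
        have hlt : Module.finrank ℝ (span ℝ (Set.range v)) < Module.finrank ℝ (Vec n) := by
          have := finrank_range_le_card (R := ℝ) v
          rw [Set.finrank] at this
          simp at this ⊢
          omega
        have hne : (span ℝ (Set.range v))ᗮ ≠ ⊥ := by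
          intro h
          rw [orthogonal_eq_bot_iff] at h
          rw [h, finrank_top] at hlt
          exact lt_irrefl _ hlt
        obtain ⟨x, hx, hx0⟩ := exists_mem_ne_zero_of_ne_bot hne
        filter_upwards [hW.ae_inner_ne_zero he0 hx0] with ω' hω' h
        rw [gramSchmidt_snocSeq] at h
        apply hω'
        rw [← (starProjection_eq_self_iff.2 hx), ← inner_starProjection_left_eq_right, h,
          inner_zero_left]
    filter_upwards [ih (by omega) ha1, key] with ω h1 h2
    refine (linearIndepOn_insert (by simp)).2 ⟨h1, fun h => h2 ?_⟩
    rw [gramSchmidt_snocSeq, ← image_Iio_eq_range (fun i => mix (W ω) (a i)),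
      starProjection_apply_eq_zero_iff, orthogonal_orthogonal]
    rw [he, starProjection_orthogonal_val, map_sub]
    exact sub_mem h (mix_mem_span _ _ _ (starProjection_apply_mem _ _))

/-- The law, for a fixed orthonormal family `b`, of the projection `w = ∑ ⟨mix e, b i⟩ b i`. -/
theorem IsWhite.map_projection (hW : IsWhite W μ) {p : ℕ} (hp : 0 < p) {b : Fin p → Vec n}
    (hb : Orthonormal ℝ b) {ρ : Type*} [Fintype ρ] [DecidableEq ρ] {e : EuclideanSpace ℝ ι}
    (he : e ≠ 0) (h : ρ → EuclideanSpace ℝ ι) (heh : ∀ j, (inner ℝ e (h j) : ℝ) = 0) :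
    μ.map (fun ω =>
      (‖∑ i, (inner ℝ (mix (W ω) e) (b i) : ℝ) • b i‖ ^ 2 / ‖e‖ ^ 2,
        (WithLp.toLp 2 fun j => (inner ℝ (mix (W ω) (h j))
          (∑ i, (inner ℝ (mix (W ω) e) (b i) : ℝ) • b i) : ℝ) /
          ‖∑ i, (inner ℝ (mix (W ω) e) (b i) : ℝ) • b i‖ : EuclideanSpace ℝ ρ))) =
      (chiSquare p).prod (multivariateGaussian 0 (Matrix.gram ℝ h)) := by
  have := hW.isProbabilityMeasure
  have hpos : 0 < ‖e‖ := norm_pos_iff.2 he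
  set e' := ‖e‖⁻¹ • e with he'
  have hnorm' : ‖e'‖ = 1 := by
    rw [he', norm_smul, norm_inv, norm_norm, inv_mul_cancel₀ hpos.ne']
  have he'0 : e' ≠ 0 := by
    intro h0
    rw [h0] at hnorm'
    simp at hnorm'
  have hm (f : EuclideanSpace ℝ ι) (x : Vec n) :
      Measurable fun ω => (inner ℝ (mix (W ω) f) x : ℝ) :=
    Measurable.inner (measurable_mix hW.measurable _) measurable_const
  set s : Ω → Fin p → ℝ := fun ω i => inner ℝ (mix (W ω) e') (b i) with hs
  set q : Ω → ρ × Fin p → ℝ := fun ω t => inner ℝ (mix (W ω) (h t.1)) (b t.2) with hq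
  have hsm : Measurable s := measurable_pi_lambda _ fun i => hm _ _
  have hqm : Measurable q := measurable_pi_lambda _ fun i => hm _ _
  have hind : IndepFun s q μ := by
    refine hW.indepFun_inner (fun _ => e') b (fun t : ρ × Fin p => h t.1) (fun t => b t.2) ?_
    intro i j
    left
    rw [he', real_inner_smul_left, heh, mul_zero]
  have hs0 : ∀ᵐ ω ∂μ, s ω ≠ 0 := by
    filter_upwards [hW.ae_inner_ne_zero he'0 (hb.ne_zero ⟨0, hp⟩)] with ω hω h0
    exact hω (congrFun h0 ⟨0, hp⟩)
  have hnorm (c : Fin p → ℝ) : ‖∑ i, c i • b i‖ ^ 2 = ∑ i, c i ^ 2 := by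
    rw [← real_inner_self_eq_norm_sq, hb.inner_sum]
    simp [pow_two]
  -- the normalized projection is a unit vector that is independent of the other columns
  set Ψ : (Fin p → ℝ) × (ρ × Fin p → ℝ) → EuclideanSpace ℝ ρ := fun x =>
    WithLp.toLp 2 fun j => (∑ i, x.1 i * x.2 (j, i)) / √(∑ i, x.1 i ^ 2) with hΨ
  have hΨm : Measurable Ψ := by
    refine (WithLp.measurable_toLp 2 _).comp (measurable_pi_lambda _ fun j => ?_)
    fun_prop
  obtain ⟨h1, h2⟩ := indepFun_of_fiberwise hsm hqm hind (Φ := fun _ => ()) measurable_const hΨm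
    (multivariateGaussian 0 (Matrix.gram ℝ h)) (by
      filter_upwards [hs0] with ω hω
      refine ⟨indepFun_const_left _ _, ?_⟩
      have hsum : 0 < ∑ i, s ω i ^ 2 := by
        obtain ⟨i, hi⟩ := Function.ne_iff.1 hω
        exact Finset.sum_pos' (fun _ _ => sq_nonneg _) ⟨i, Finset.mem_univ _, by
          have : s ω i ≠ 0 := hi
          positivity⟩
      set v : Vec n := (√(∑ i, s ω i ^ 2))⁻¹ • ∑ i, s ω i • b i with hv
      have hv1 : ‖v‖ = 1 := by
        rw [hv, norm_smul, norm_inv, Real.norm_of_nonneg (Real.sqrt_nonneg _), ← hnorm,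
          Real.sqrt_sq (norm_nonneg _), inv_mul_cancel₀]
        intro h0
        have := hnorm (s ω)
        rw [h0] at this
        simp at this
        linarith
      rw [← hW.map_inner_unit h hv1]
      congr 1
      ext ω' j
      simp only [hΨ, hv, hq, inner_smul_right, inner_sum]
      rw [div_eq_inv_mul])
  have h3 : IndepFun (fun ω => ∑ i, s ω i ^ 2) (fun ω => Ψ (s ω, q ω)) μ :=
    h1.comp (φ := fun x : (Fin p → ℝ) × Unit => ∑ i, x.1 i ^ 2) (ψ := id) (by fun_prop)
      measurable_id
  have hsq : Measurable fun ω => ∑ i, s ω i ^ 2 := by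
    have : ∀ i, Measurable fun ω => s ω i := fun i => hm _ _
    fun_prop
  have h4 : μ.map (fun ω => ∑ i, s ω i ^ 2) = chiSquare p := by
    rw [chiSquare, ← hW.map_inner_orthonormal hnorm' hb, Measure.map_map (by fun_prop) hsm]
    rfl
  have h5 := (indepFun_iff_map_prod_eq_prod_map_map hsq.aemeasurable
    (hΨm.comp (hsm.prodMk hqm)).aemeasurable).1 h3
  rw [h4] at h5
  rw [← h2]
  refine Eq.trans ?_ h5
  congr 1
  ext1 ω
  have hw : ∑ i, (inner ℝ (mix (W ω) e) (b i) : ℝ) • b i = ‖e‖ • ∑ i, s ω i • b i := by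
    rw [Finset.smul_sum]
    refine Finset.sum_congr rfl fun i _ => ?_
    rw [smul_smul, hs]
    simp only [he', map_smul, real_inner_smul_left]
    rw [mul_inv_cancel_left₀ hpos.ne']
  rw [hw]
  refine Prod.ext ?_ ?_
  · simp only [norm_smul, norm_norm, mul_pow]
    rw [hnorm, mul_div_cancel_left₀ _ (by positivity)]
  · ext j
    simp only [norm_smul, norm_norm, inner_smul_right, inner_sum]
    rw [mul_div_mul_left _ _ hpos.ne', ← Real.sqrt_sq (norm_nonneg (∑ i, s ω i • b i)), hnorm]
    rfl

/-- Projecting off one more vector `a m` amounts to subtracting the component along its residual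
`e`. -/
theorem starProjection_orthogonal_span_Iic {H : Type*} [NormedAddCommGroup H]
    [InnerProductSpace ℝ H] [FiniteDimensional ℝ H] (a : ℕ → H) (m : ℕ) (y : H) {e : H}
    (he : e = (span ℝ (a '' Set.Iio m))ᗮ.starProjection (a m)) (he0 : e ≠ 0) :
    (span ℝ (a '' Set.Iic m))ᗮ.starProjection y =
      (span ℝ (a '' Set.Iio m))ᗮ.starProjection y - ((inner ℝ y e : ℝ) / ‖e‖ ^ 2) • e := by
  set K := span ℝ (a '' Set.Iio m)
  have hpos : 0 < ‖e‖ := norm_pos_iff.2 he0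
  have heK : e ∈ Kᗮ := he ▸ starProjection_apply_mem _ _
  have hsub : K ≤ span ℝ (a '' Set.Iic m) :=
    span_mono (Set.image_mono Set.Iio_subset_Iic_self)
  have ham : a m = K.starProjection (a m) + e := by
    rw [he, starProjection_orthogonal_val, add_sub_cancel]
  have hem : e ∈ span ℝ (a '' Set.Iic m) := by
    rw [he, starProjection_orthogonal_val]
    exact sub_mem (subset_span ⟨m, by simp, rfl⟩) (hsub (starProjection_apply_mem _ _))
  set r := Kᗮ.starProjection y - ((inner ℝ y e : ℝ) / ‖e‖ ^ 2) • e with hr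
  have hrK : r ∈ Kᗮ := sub_mem (starProjection_apply_mem _ _) (smul_mem _ _ heK)
  have hre : (inner ℝ e r : ℝ) = 0 := by
    rw [hr, inner_sub_right, ← inner_starProjection_left_eq_right,
      starProjection_eq_self_iff.2 heK, real_inner_smul_right, real_inner_self_eq_norm_sq,
      real_inner_comm, div_mul_cancel₀ _ (by positivity), sub_self]
  refine eq_starProjection_of_mem_orthogonal ?_ ?_
  · rw [mem_orthogonal]
    intro u hu
    induction hu using span_induction with
    | mem x hx =>
      obtain ⟨i, hi, rfl⟩ := hx
      rcases (Set.mem_Iic.1 hi).lt_or_eq with h | rfl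
      · exact (mem_orthogonal _ _).1 hrK _ (subset_span ⟨i, h, rfl⟩)
      · rw [ham, inner_add_left, hre, add_zero]
        exact (mem_orthogonal _ _).1 hrK _ (starProjection_apply_mem _ _)
    | zero => simp
    | add x y _ _ hx hy => rw [inner_add_left, hx, hy, add_zero]
    | smul c x _ hx => rw [real_inner_smul_left, hx, mul_zero]
  · rw [orthogonal_orthogonal, hr, starProjection_orthogonal_val, sub_sub_eq_add_sub,
      ← sub_add, add_comm y, add_sub_assoc]
    have : ((inner ℝ y e : ℝ) / ‖e‖ ^ 2) • e + (y - (y - K.starProjection y)) ∈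
        span ℝ (a '' Set.Iic m) := by
      rw [sub_sub_cancel]
      exact add_mem (smul_mem _ _ hem) (hsub (starProjection_apply_mem _ _))
    convert this using 1
    abel

/-- One step of the Gram–Schmidt recursion for white noise. The vectors `mix W (a i)` are
orthogonalized to `G 0, …, G m`. The statistics of step `m`, corrected by their component along
the residual `e` of `a m`, are independent of the earlier vectors and statistics. -/
theorem IsWhite.step (hW : IsWhite W μ) (a : ℕ → EuclideanSpace ℝ ι) (m : ℕ) (hm : m < n)
    (ha : LinearIndepOn ℝ a (Set.Iic m)) {κ ρ : Type*} [Fintype κ] [Fintype ρ] [DecidableEq ρ]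
    (x : κ → EuclideanSpace ℝ ι) (y : ρ → EuclideanSpace ℝ ι) {e : EuclideanSpace ℝ ι}
    (he : e = (span ℝ (a '' Set.Iio m))ᗮ.starProjection (a m)) (G : ℕ → Ω → Vec n)
    (hG : ∀ i ω, G i ω = gramSchmidt ℝ (fun i => mix (W ω) (a i)) i) :
    IndepFun
      (fun ω (i : Fin m) => (G i ω, fun j : κ => (inner ℝ (mix (W ω) (x j)) (G i ω) : ℝ) /
        ‖G i ω‖))
      (fun ω => (‖G m ω‖ ^ 2 / ‖e‖ ^ 2, (WithLp.toLp 2 fun j =>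
        (inner ℝ (mix (W ω) (y j)) (G m ω) : ℝ) / ‖G m ω‖ -
          (inner ℝ (y j) e : ℝ) / ‖e‖ ^ 2 * ‖G m ω‖ : EuclideanSpace ℝ ρ))) μ ∧
    μ.map (fun ω => (‖G m ω‖ ^ 2 / ‖e‖ ^ 2, (WithLp.toLp 2 fun j =>
        (inner ℝ (mix (W ω) (y j)) (G m ω) : ℝ) / ‖G m ω‖ -
          (inner ℝ (y j) e : ℝ) / ‖e‖ ^ 2 * ‖G m ω‖ : EuclideanSpace ℝ ρ))) =
      (chiSquare (n - m)).prod (multivariateGaussian 0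
        (Matrix.gram ℝ fun j => (span ℝ (a '' Set.Iic m))ᗮ.starProjection (y j))) := by
  have := hW.isProbabilityMeasure
  have hI : Set.Iic m = insert m (Set.Iio m) := by
    ext i
    simp only [Set.mem_Iio, Set.mem_Iic, Set.mem_insert_iff]
    omega
  have ha' := ha
  rw [hI] at ha'
  obtain ⟨ha1, ha2⟩ := (linearIndepOn_insert (by simp)).1 ha'
  set K := span ℝ (a '' Set.Iio m) with hK
  have he0 : e ≠ 0 := by
    intro h
    rw [he, starProjection_apply_eq_zero_iff, orthogonal_orthogonal] at h
    exact ha2 h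
  have hpos : 0 < ‖e‖ := norm_pos_iff.2 he0
  have heK : e ∈ Kᗮ := he ▸ starProjection_apply_mem _ _
  set h : ρ → EuclideanSpace ℝ ι := fun j =>
    (span ℝ (a '' Set.Iic m))ᗮ.starProjection (y j) with hh
  have hhK (j : ρ) : h j ∈ Kᗮ :=
    orthogonal_le (span_mono (Set.image_mono Set.Iio_subset_Iic_self))
      (starProjection_apply_mem _ _)
  have heh (j : ρ) : (inner ℝ e (h j) : ℝ) = 0 := by
    refine (mem_orthogonal _ _).1 (starProjection_apply_mem _ (y j)) _ ?_
    rw [he, starProjection_orthogonal_val]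
    exact sub_mem (subset_span ⟨m, by simp, rfl⟩)
      (span_mono (Set.image_mono Set.Iio_subset_Iic_self) (starProjection_apply_mem _ _))
  have hdec (j : ρ) : y j = K.starProjection (y j) + ((inner ℝ (y j) e : ℝ) / ‖e‖ ^ 2) • e
      + h j := by
    rw [hh]
    simp only
    rw [starProjection_orthogonal_span_Iic a m (y j) he he0, starProjection_orthogonal_val]
    abel
  set b : κ ⊕ Option ρ → EuclideanSpace ℝ ι :=
    Sum.elim (fun j => Kᗮ.starProjection (x j)) (fun o => o.elim e h) with hb
  have hbK (t) : b t ∈ Kᗮ := by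
    rcases t with j | _ | j
    · exact starProjection_apply_mem _ _
    · exact heK
    · exact hhK j
  set V : Ω → Fin m → Vec n := fun ω i => mix (W ω) (a i) with hV
  set U : Ω → κ ⊕ Option ρ → Vec n := fun ω t => mix (W ω) (b t) with hU
  have hVm : Measurable V := measurable_pi_lambda _ fun i => measurable_mix hW.measurable _
  have hUm : Measurable U := measurable_pi_lambda _ fun i => measurable_mix hW.measurable _
  have hVU : IndepFun V U μ := hW.indepFun_past a m b hbK
  set g : (Fin m → Vec n) → ℕ → Vec n := fun v i => gramSchmidt ℝ (snocSeq v 0) i with hg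
  set r : (Fin m → Vec n) × (κ ⊕ Option ρ → Vec n) → Vec n := fun z =>
    gramSchmidt ℝ (snocSeq z.1 (z.2 (.inr none))) m with hr
  set Φ : (Fin m → Vec n) × (κ ⊕ Option ρ → Vec n) → κ × Fin m → ℝ := fun z t =>
    inner ℝ (z.2 (.inl t.1)) (g z.1 t.2) with hΦ
  set Ψ : (Fin m → Vec n) × (κ ⊕ Option ρ → Vec n) → ℝ × EuclideanSpace ℝ ρ := fun z =>
    (‖r z‖ ^ 2 / ‖e‖ ^ 2, WithLp.toLp 2 fun j => inner ℝ (z.2 (.inr (some j))) (r z) / ‖r z‖)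
    with hΨ
  have hgm (i : ℕ) : Measurable fun v => g v i :=
    measurable_gramSchmidt_snocSeq measurable_id measurable_const i
  have hrm : Measurable r :=
    measurable_gramSchmidt_snocSeq (α := (Fin m → Vec n) × (κ ⊕ Option ρ → Vec n)) measurable_fst
      ((measurable_pi_apply (Sum.inr none)).comp measurable_snd) m
  have hΦm : Measurable Φ := measurable_pi_lambda _ fun t =>
    Measurable.inner ((measurable_pi_apply _).comp measurable_snd)
      ((hgm t.2).comp measurable_fst)
  have hΨm : Measurable Ψ := by
    refine Measurable.prodMk (by fun_prop) ?_
    refine (WithLp.measurable_toLp 2 _).comp (measurable_pi_lambda _ fun j => ?_)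
    exact (Measurable.inner ((measurable_pi_apply _).comp measurable_snd) hrm).div hrm.norm
  -- `V` holds the earlier vectors, and `U` is independent of it: its components along the span of
  -- `V` give the earlier statistics, those along the orthogonal complement give the current ones
  have key := indepFun_of_fiberwise hVm hUm hVU hΦm hΨm
    ((chiSquare (n - m)).prod (multivariateGaussian 0 (Matrix.gram ℝ h))) (by
      filter_upwards [hW.ae_linearIndepOn a m hm.le ha1] with ω hω
      set F := span ℝ (Set.range (V ω)) with hF
      have hrank : Module.finrank ℝ Fᗮ = n - m := by
        have h1 : LinearIndependent ℝ (V ω) :=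
          LinearIndependent.comp hω (fun i : Fin m => ⟨i, i.2⟩) fun i j hij =>
            Fin.ext (congrArg Subtype.val hij)
        have h2 : Module.finrank ℝ F = m := by
          rw [hF, finrank_span_eq_card h1, Fintype.card_fin]
        have h3 := F.finrank_add_finrank_orthogonal
        rw [h2, finrank_euclideanSpace_fin] at h3
        omega
      set B := (stdOrthonormalBasis ℝ Fᗮ).reindex (finCongr hrank) with hB
      have hBo : Orthonormal ℝ fun i => (B i : Vec n) :=
        B.orthonormal.comp_linearIsometry Fᗮ.subtypeₗᵢ
      have hBr (u : Vec n) : Fᗮ.starProjection u = ∑ i, (inner ℝ u (B i : Vec n) : ℝ) •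
          (B i : Vec n) := by
        rw [B.starProjection_eq_sum_rankOne]
        simp [real_inner_comm]
      have hrB (ω' : Ω) : r (V ω, U ω') = ∑ i, (inner ℝ (mix (W ω') e) (B i : Vec n) : ℝ) •
          (B i : Vec n) := by
        rw [hr]
        simp only
        rw [gramSchmidt_snocSeq, ← hBr]
        rfl
      have hgF (i : Fin m) : g (V ω) i ∈ F := by
        have := gramSchmidt_mem_span ℝ (snocSeq (V ω) 0) (le_refl (i : ℕ))
        refine span_mono ?_ this
        rw [← image_snocSeq (V ω) 0]
        exact Set.image_mono fun l hl => lt_of_le_of_lt hl i.2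
      refine ⟨?_, ?_⟩
      · have hind := hW.indepFun_inner (fun t : κ × Fin m => b (.inl t.1))
          (fun t => g (V ω) t.2) (fun t : Option ρ × Fin (n - m) => b (.inr t.1))
          (fun t => (B t.2 : Vec n))
          (fun i j => Or.inr ((mem_orthogonal _ _).1 (B j.2).2 _ (hgF i.2)))
        -- the future of the step as a function of the coordinates in the basis `B`
        have hψ : Measurable fun q : Option ρ × Fin (n - m) → ℝ =>
            ((‖∑ i, q (none, i) • (B i : Vec n)‖ ^ 2 / ‖e‖ ^ 2,
              WithLp.toLp 2 fun j => (∑ i, q (none, i) * q (some j, i)) /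
                ‖∑ i, q (none, i) • (B i : Vec n)‖) : ℝ × EuclideanSpace ℝ ρ) := by
          refine Measurable.prodMk (by fun_prop) ?_
          refine (WithLp.measurable_toLp 2 _).comp (measurable_pi_lambda _ fun j => ?_)
          fun_prop
        have := hind.comp measurable_id hψ
        convert this using 1
        · rfl
        · ext1 ω'
          simp only [hΨ, hrB, Function.comp]
          simp only [inner_sum, inner_smul_right]
          rfl
      · have := hW.map_projection (p := n - m) (by omega) hBo he0 h heh
        rw [← this]
        congr 1
        ext1 ω'
        simp only [hΨ, hrB]
        rfl)
  have hFeq (ω : Ω) : (fun i => mix (W ω) (a i)) '' Set.Iio m = Set.range (V ω) :=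
    image_Iio_eq_range _ _
  have hmixF (ω : Ω) {z : EuclideanSpace ℝ ι} (hz : z ∈ K) :
      mix (W ω) z ∈ span ℝ (Set.range (V ω)) := by
    rw [← hFeq]
    exact mix_mem_span _ _ _ hz
  have hGm (ω : Ω) : G m ω = r (V ω, U ω) := by
    rw [hG, gramSchmidt_eq_starProjection, hr]
    simp only
    rw [gramSchmidt_snocSeq, hFeq]
    have h1 : a m = K.starProjection (a m) + e := by
      rw [he, starProjection_orthogonal_val, add_sub_cancel]
    rw [h1, map_add, map_add]
    have h2 : (span ℝ (Set.range (V ω)))ᗮ.starProjection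
        (mix (W ω) (K.starProjection (a m))) = 0 := by
      rw [starProjection_apply_eq_zero_iff, orthogonal_orthogonal]
      exact hmixF ω (starProjection_apply_mem _ _)
    rw [h2, zero_add]
    rfl
  have hGi (ω : Ω) (i : Fin m) : G i ω = g (V ω) i := by
    rw [hG, hg]
    refine gramSchmidt_congr fun l hl => ?_
    have : l < m := lt_of_le_of_lt hl i.2
    simp [snocSeq, this, hV]
  have hfut : (fun ω => (‖G m ω‖ ^ 2 / ‖e‖ ^ 2, (WithLp.toLp 2 fun j =>
        (inner ℝ (mix (W ω) (y j)) (G m ω) : ℝ) / ‖G m ω‖ -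
          (inner ℝ (y j) e : ℝ) / ‖e‖ ^ 2 * ‖G m ω‖ : EuclideanSpace ℝ ρ))) =
      fun ω => Ψ (V ω, U ω) := by
    ext1 ω
    simp only [hΨ, ← hGm]
    refine Prod.ext rfl ?_
    ext j
    simp only
    have hGF : G m ω ∈ (span ℝ (Set.range (V ω)))ᗮ := by
      rw [hG, gramSchmidt_eq_starProjection, hFeq]
      exact starProjection_apply_mem _ _
    have h1 : (inner ℝ (mix (W ω) (K.starProjection (y j))) (G m ω) : ℝ) = 0 :=
      (mem_orthogonal _ _).1 hGF _ (hmixF ω (starProjection_apply_mem _ _))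
    have h2 : (inner ℝ (mix (W ω) e) (G m ω) : ℝ) = ‖G m ω‖ ^ 2 := by
      have h3 : G m ω = (span ℝ (Set.range (V ω)))ᗮ.starProjection (mix (W ω) e) := by
        rw [hGm, hr]
        simp only
        rw [gramSchmidt_snocSeq]
        rfl
      conv_lhs => rw [← starProjection_eq_self_iff.2 hGF]
      rw [← inner_starProjection_left_eq_right, ← h3, real_inner_self_eq_norm_sq]
    have h4 : (inner ℝ (mix (W ω) (y j)) (G m ω) : ℝ) =
        (inner ℝ (y j) e : ℝ) / ‖e‖ ^ 2 * ‖G m ω‖ ^ 2 + inner ℝ (mix (W ω) (h j)) (G m ω) := by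
      conv_lhs => rw [hdec j]
      rw [map_add, map_add, map_smul, inner_add_left, inner_add_left, h1, real_inner_smul_left,
        h2, zero_add]
    rw [h4]
    have h5 : U ω (.inr (some j)) = mix (W ω) (h j) := rfl
    rw [h5]
    -- for `G m ω = 0` all statistics vanish, since `x / 0 = 0`
    by_cases h0 : ‖G m ω‖ = 0
    · simp [h0]
    · field_simp
      ring
  rw [hfut]
  refine ⟨?_, key.2⟩
  -- the part of `mix W (x j)` in the span of the earlier vectors is a function of these, so the
  -- earlier statistics are functions `f` of the earlier vectors and of `Φ`
  have hex (j : κ) : ∃ c : Fin m → ℝ, ∑ i, c i • a i = K.starProjection (x j) := by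
    refine (mem_span_range_iff_exists_fun ℝ).1 ?_
    rw [← image_Iio_eq_range]
    exact starProjection_apply_mem _ _
  choose c hc using hex
  set f : (Fin m → Vec n) × (κ × Fin m → ℝ) → Fin m → Vec n × (κ → ℝ) := fun z i =>
    (g z.1 i, fun j => (inner ℝ (∑ l, c j l • z.1 l) (g z.1 i) + z.2 (j, i)) / ‖g z.1 i‖) with hf
  have hfm : Measurable f := by
    refine measurable_pi_lambda _ fun i => ((hgm i).comp measurable_fst).prodMk
      (measurable_pi_lambda _ fun j => ?_)
    have hg' : Measurable fun z : (Fin m → Vec n) × (κ × Fin m → ℝ) => g z.1 i :=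
      (hgm i).comp measurable_fst
    refine ((Measurable.inner ?_ hg').add (by fun_prop)).div hg'.norm
    refine Finset.measurable_sum _ fun l _ => ?_
    have hl : Measurable fun z : (Fin m → Vec n) × (κ × Fin m → ℝ) => z.1 l :=
      (measurable_pi_apply l).comp measurable_fst
    exact hl.const_smul (c j l)
  have := key.1.comp hfm measurable_id
  convert this using 1
  swap
  · rfl
  ext1 ω
  funext i
  simp only [Function.comp, hf, ← hGi]
  refine Prod.ext rfl ?_
  funext j
  simp only [hΦ, ← hGi]
  congr 1
  have h1 : ∑ l, c j l • V ω l = mix (W ω) (K.starProjection (x j)) := by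
    rw [← hc, map_sum]
    simp [hV]
  rw [h1, ← inner_add_left]
  have h2 : U ω (.inl j) = mix (W ω) (Kᗮ.starProjection (x j)) := rfl
  rw [h2, ← map_add, starProjection_orthogonal_val, add_sub_cancel]

end Step

/-! ### Residuals of orthogonal families -/

section Residual

open Submodule

variable {H : Type*} [NormedAddCommGroup H] [InnerProductSpace ℝ H]

/-- The part of `a 0` that is orthogonal to `a 1, …, a (l - 1)`, if these are orthogonal to each
other. Vanishing vectors contribute nothing, since `x / 0 = 0`. -/
def residual (a : ℕ → H) (l : ℕ) : H :=
  a 0 - ∑ i ∈ Finset.Ico 1 l, ((inner ℝ (a i) (a 0) : ℝ) / ‖a i‖ ^ 2) • a i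

variable {a : ℕ → H} {l : ℕ}

theorem inner_residual (ha : ∀ i ∈ Finset.Ico 1 l, ∀ j ∈ Finset.Ico 1 l, i ≠ j →
    (inner ℝ (a i) (a j) : ℝ) = 0) {i : ℕ} (hi : i ∈ Finset.Ico 1 l) :
    (inner ℝ (a i) (residual a l) : ℝ) = 0 := by
  rw [residual, inner_sub_right, inner_sum, Finset.sum_eq_single_of_mem i hi]
  · rw [real_inner_smul_right, real_inner_self_eq_norm_sq]
    by_cases h : a i = 0
    · simp [h]
    · rw [div_mul_cancel₀ _ (by positivity), sub_self]
  · intro j hj hij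
    rw [real_inner_smul_right, ha i hi j hj hij.symm, mul_zero]

theorem inner_residual_of_forall {u : H} (hu : ∀ i ∈ Finset.Ico 1 l, (inner ℝ u (a i) : ℝ) = 0) :
    (inner ℝ u (residual a l) : ℝ) = inner ℝ u (a 0) := by
  rw [residual, inner_sub_right, inner_sum, Finset.sum_eq_zero, sub_zero]
  intro i hi
  rw [real_inner_smul_right, hu i hi, mul_zero]

theorem norm_residual_sq (ha : ∀ i ∈ Finset.Ico 1 l, ∀ j ∈ Finset.Ico 1 l, i ≠ j →
    (inner ℝ (a i) (a j) : ℝ) = 0) :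
    ‖residual a l‖ ^ 2 =
      ‖a 0‖ ^ 2 - ∑ i ∈ Finset.Ico 1 l, (inner ℝ (a i) (a 0) : ℝ) ^ 2 / ‖a i‖ ^ 2 := by
  have h : (inner ℝ (residual a l) (residual a l) : ℝ) = inner ℝ (a 0) (residual a l) := by
    rw [inner_residual_of_forall fun i hi => by rw [real_inner_comm, inner_residual ha hi],
      real_inner_comm]
  rw [← real_inner_self_eq_norm_sq, h, residual, inner_sub_right, inner_sum,
    real_inner_self_eq_norm_sq]
  congr 1
  refine Finset.sum_congr rfl fun i _ => ?_
  rw [real_inner_smul_right, real_inner_comm]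
  ring

/-- If `u` is orthogonal to `a 1, …, a (l - 1)`, and these to each other, then only the residual of
`a 0` contributes to the projection of `u` onto the span of `a 0, …, a (l - 1)`. -/
theorem starProjection_orthogonal_eq_sub_residual [FiniteDimensional ℝ H] (hl : 1 ≤ l)
    (ha : ∀ i ∈ Finset.Ico 1 l, ∀ j ∈ Finset.Ico 1 l, i ≠ j → (inner ℝ (a i) (a j) : ℝ) = 0)
    (h0 : residual a l ≠ 0) {u : H} (hu : ∀ i ∈ Finset.Ico 1 l, (inner ℝ u (a i) : ℝ) = 0) :
    (span ℝ (a '' Set.Iio l))ᗮ.starProjection u =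
      u - ((inner ℝ u (a 0) : ℝ) / ‖residual a l‖ ^ 2) • residual a l := by
  have hpos : 0 < ‖residual a l‖ := norm_pos_iff.2 h0
  have hi (i : ℕ) (hi : i ∈ Finset.Ico 1 l) : (inner ℝ (a i)
      (u - ((inner ℝ u (a 0) : ℝ) / ‖residual a l‖ ^ 2) • residual a l) : ℝ) = 0 := by
    rw [inner_sub_right, real_inner_smul_right, inner_residual ha hi, real_inner_comm, hu i hi]
    simp
  refine eq_starProjection_of_mem_orthogonal ?_ ?_
  · rw [mem_orthogonal]
    intro z hz
    induction hz using span_induction with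
    | mem x hx =>
      obtain ⟨i, hil, rfl⟩ := hx
      rcases Nat.eq_zero_or_pos i with rfl | hpos'
      · rw [real_inner_comm, ← inner_residual_of_forall fun i h => by
          rw [real_inner_comm, hi i h], inner_sub_left, inner_residual_of_forall hu,
          real_inner_smul_left, real_inner_self_eq_norm_sq, div_mul_cancel₀ _ (by positivity),
          sub_self]
      · exact hi i (Finset.mem_Ico.2 ⟨hpos', hil⟩)
    | zero => simp
    | add x y _ _ hx hy => rw [inner_add_left, hx, hy, add_zero]
    | smul c x _ hx => rw [real_inner_smul_left, hx, mul_zero]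
  · rw [sub_sub_cancel, orthogonal_orthogonal]
    refine smul_mem _ _ (sub_mem (subset_span ⟨0, by simp; omega, rfl⟩) (sum_mem fun i hi => ?_))
    exact smul_mem _ _ (subset_span ⟨i, (Finset.mem_Ico.1 hi).2, rfl⟩)

end Residual

/-! ### The vectors of coefficients -/

namespace Code

variable {L M : ℕ} (c : Code L M)

theorem P_nonneg : 0 ≤ c.P := Finset.sum_nonneg fun ℓ _ => (c.power_pos ℓ).le

theorem powerAt_pos (j : Term L M) : 0 < c.powerAt j := c.power_pos _

theorem P_pos (j : Term L M) : 0 < c.P :=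
  Finset.sum_pos (fun ℓ _ => c.power_pos ℓ) ⟨j.1, Finset.mem_univ _⟩

theorem P_mul_π (j : Term L M) : c.P * c.π j = c.powerAt j := by
  rw [π, mul_div_cancel₀ _ (c.P_pos j).ne']

theorem π_pos (j : Term L M) : 0 < c.π j := div_pos (c.powerAt_pos j) (c.P_pos j)

theorem P_add_pos : 0 < c.P + (c.σ : ℝ) ^ 2 := by
  have h1 := c.P_nonneg
  have h2 : (0 : ℝ) < c.σ := c.σ_pos
  positivity

theorem P_add_mul_ν : (c.P + (c.σ : ℝ) ^ 2) * c.ν = c.P := by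
  rw [ν, mul_div_cancel₀ _ c.P_add_pos.ne']

theorem ν_nonneg : 0 ≤ c.ν := div_nonneg c.P_nonneg c.P_add_pos.le

theorem sum_sent (f : Term L M → ℝ) : ∑ j ∈ c.sent, f j = ∑ ℓ, f (ℓ, c.msg ℓ) := by
  rw [sent, Finset.sum_filter, Fintype.sum_prod_type]
  simp

theorem β_sq (j : Term L M) : c.β j ^ 2 = if j ∈ c.sent then c.powerAt j else 0 := by
  rw [β]
  split_ifs
  · exact Real.sq_sqrt (c.powerAt_pos j).le
  · simp

theorem sum_β_sq : ∑ j, c.β j ^ 2 = c.P := by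
  simp only [β_sq]
  rw [← Finset.sum_filter, Finset.filter_mem_eq_inter, Finset.univ_inter, sum_sent]
  rfl

/-- The coefficients of the vectors `Y, -F_1, -F_2, …`, if `d i` is the set of the terms decoded in
step `i`. The index `none` stands for the noise, normalized to variance one. -/
def coef (d : ℕ → Finset (Term L M)) : ℕ → EuclideanSpace ℝ (Option (Term L M))
  | 0 => WithLp.toLp 2 fun o => o.elim (c.σ : ℝ) c.β
  | i + 1 => WithLp.toLp 2 fun o => o.elim 0 fun j =>
      if j ∈ d (i + 1) then -√(c.powerAt j) else 0

variable {c} {d : ℕ → Finset (Term L M)}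

theorem coef_none {i : ℕ} (hi : 1 ≤ i) : c.coef d i none = 0 := by
  obtain ⟨i, rfl⟩ := Nat.exists_eq_add_of_le' hi
  rfl

theorem coef_some {i : ℕ} (hi : 1 ≤ i) (j : Term L M) :
    c.coef d i (some j) = if j ∈ d i then -√(c.powerAt j) else 0 := by
  obtain ⟨i, rfl⟩ := Nat.exists_eq_add_of_le' hi
  rfl

theorem inner_option (a b : EuclideanSpace ℝ (Option (Term L M))) :
    (inner ℝ a b : ℝ) = a none * b none + ∑ j, a (some j) * b (some j) := by
  simp only [PiLp.inner_apply, Fintype.sum_option, RCLike.inner_apply, conj_trivial]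
  rw [mul_comm]
  congr 1
  exact Finset.sum_congr rfl fun j _ => mul_comm _ _

theorem norm_coef_zero_sq : ‖c.coef d 0‖ ^ 2 = c.P + (c.σ : ℝ) ^ 2 := by
  rw [← real_inner_self_eq_norm_sq, inner_option, ← c.sum_β_sq]
  simp only [coef, Option.elim, ← pow_two]
  ring

theorem inner_coef_zero {i : ℕ} (hi : 1 ≤ i) :
    (inner ℝ (c.coef d i) (c.coef d 0) : ℝ) = -(c.P * ∑ j ∈ c.sent ∩ d i, c.π j) := by
  rw [inner_option, coef_none hi, zero_mul, zero_add, Finset.mul_sum, ← Finset.sum_neg_distrib,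
    ← Finset.sum_subset (Finset.subset_univ (c.sent ∩ d i))]
  · refine Finset.sum_congr rfl fun j hj => ?_
    rw [Finset.mem_inter] at hj
    rw [coef_some hi, if_pos hj.2, P_mul_π]
    simp only [coef, Option.elim, β, if_pos hj.1]
    rw [neg_mul, Real.mul_self_sqrt (c.powerAt_pos j).le]
  · intro j _ hj
    rw [coef_some hi]
    simp only [coef, Option.elim, β]
    rw [Finset.mem_inter] at hj
    split_ifs <;> simp_all

theorem norm_coef_sq {i : ℕ} (hi : 1 ≤ i) : ‖c.coef d i‖ ^ 2 = c.P * ∑ j ∈ d i, c.π j := by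
  rw [← real_inner_self_eq_norm_sq, inner_option, coef_none hi, zero_mul, zero_add,
    Finset.mul_sum, ← Finset.sum_subset (Finset.subset_univ (d i))]
  · refine Finset.sum_congr rfl fun j hj => ?_
    rw [coef_some hi, if_pos hj, P_mul_π, neg_mul_neg, Real.mul_self_sqrt (c.powerAt_pos j).le]
  · intro j _ hj
    rw [coef_some hi, if_neg hj, zero_mul]

theorem inner_coef_of_disjoint {i i' : ℕ} (hi : 1 ≤ i) (hi' : 1 ≤ i')
    (h : Disjoint (d i) (d i')) : (inner ℝ (c.coef d i) (c.coef d i') : ℝ) = 0 := by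
  rw [inner_option, coef_none hi, zero_mul, zero_add, Finset.sum_eq_zero]
  intro j _
  rw [coef_some hi, coef_some hi']
  by_cases hj : j ∈ d i
  · rw [if_neg (Finset.disjoint_left.1 h hj), mul_zero]
  · rw [if_neg hj, zero_mul]

/-- The vector of coefficients of the column `X_j`. -/
def column (j : Term L M) : EuclideanSpace ℝ (Option (Term L M)) :=
  EuclideanSpace.single (some j) 1

theorem inner_column (j : Term L M) (a : EuclideanSpace ℝ (Option (Term L M))) :
    (inner ℝ (column j) a : ℝ) = a (some j) := by
  simp [column, EuclideanSpace.inner_single_left]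

/-- The noise has coefficient `σ ≠ 0` in `Y` and coefficient `0` in every `F_i`, and the `F_i`
involve disjoint nonempty sets of columns. -/
theorem linearIndepOn_coef {m : ℕ}
    (hd : ∀ i ∈ Finset.Icc 1 m, ∀ j ∈ Finset.Icc 1 m, i ≠ j → Disjoint (d i) (d j))
    (hne : ∀ i ∈ Finset.Icc 1 m, (d i).Nonempty) :
    LinearIndepOn ℝ (c.coef d) (Set.Iic m) := by
  have hI : Set.Iic m = insert 0 (Set.Icc 1 m) := by
    ext i
    simp only [Set.mem_Iic, Set.mem_insert_iff, Set.mem_Icc]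
    omega
  rw [hI]
  refine LinearIndepOn.insert ?_ ?_
  · refine linearIndependent_of_ne_zero_of_inner_eq_zero ?_ ?_
    · rintro ⟨i, hi⟩ h0
      have h1 := norm_coef_sq (c := c) (d := d) hi.1
      obtain ⟨j, hj⟩ := hne i (Finset.mem_Icc.2 hi)
      have h2 : 0 < ∑ j ∈ d i, c.π j := Finset.sum_pos (fun j _ => c.π_pos j) ⟨j, hj⟩
      have h3 := mul_pos (c.P_pos j) h2
      have h0' : c.coef d i = 0 := h0
      rw [← h1, h0'] at h3
      simp at h3
    · rintro ⟨i, hi⟩ ⟨j, hj⟩ hij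
      exact inner_coef_of_disjoint hi.1 hj.1 (hd i (Finset.mem_Icc.2 hi) j (Finset.mem_Icc.2 hj)
        fun h => hij (Subtype.ext h))
  · -- the span of the `F_i` does not involve the noise
    intro h
    have hz : ∀ x ∈ Submodule.span ℝ (c.coef d '' Set.Icc 1 m), x none = 0 := by
      intro x hx
      induction hx using Submodule.span_induction with
      | mem x hx =>
        obtain ⟨i, hi, rfl⟩ := hx
        exact coef_none hi.1
      | zero => rfl
      | add x y _ _ hx hy => rw [PiLp.add_apply, hx, hy, add_zero]
      | smul t x _ hx => rw [PiLp.smul_apply, hx, smul_zero]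
    have h1 : (c.σ : ℝ) = 0 := hz _ h
    have h2 : (0 : ℝ) < c.σ := c.σ_pos
    exact h2.ne' h1

end Code

namespace Trial

variable {L M n : ℕ} (r : Trial L M n)

/-! ### The weights of the decoded terms -/

theorem disjoint_dec {i j : ℕ} (hi : 1 ≤ i) (hj : 1 ≤ j) (hij : i ≠ j) :
    Disjoint (r.dec i) (r.dec j) := by
  wlog h : i < j generalizing i j
  · exact (this hj hi hij.symm (by omega)).symm
  rw [Finset.disjoint_right]
  intro t ht hti
  rw [r.dec_eq j hj] at ht
  exact (r.decoder.select_subset _ _ _ t ht).1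
    (Finset.mem_biUnion.2 ⟨i, Finset.mem_Ico.2 ⟨hi, h⟩, hti⟩)

theorem qHat_nonneg (i : ℕ) : 0 ≤ r.qHat i := Finset.sum_nonneg fun j _ => (r.code.π_pos j).le

theorem fHat_nonneg (i : ℕ) : 0 ≤ r.fHat i := Finset.sum_nonneg fun j _ => (r.code.π_pos j).le

theorem qHat_add_fHat (i : ℕ) : r.qHat i + r.fHat i = ∑ j ∈ r.dec i, r.code.π j := by
  rw [qHat, fHat, ← Finset.sum_inter_add_sum_sdiff (r.dec i) r.code.sent, Finset.inter_comm]

/-- The adjusted weight is `q̂_i² / (q̂_i + f̂_i)`, in a form that also holds if nothing was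
decoded. -/
theorem qAdj_mul (i : ℕ) : r.qAdj i * (r.qHat i + r.fHat i) = r.qHat i ^ 2 := by
  have hq := r.qHat_nonneg i
  have hf := r.fHat_nonneg i
  rw [qAdj]
  by_cases h : r.qHat i = 0
  · simp [h]
  · have : 0 < r.qHat i := lt_of_le_of_ne hq (Ne.symm h)
    have h2 : 0 < r.qHat i + r.fHat i := by positivity
    field_simp

theorem qAdj_nonneg (i : ℕ) : 0 ≤ r.qAdj i := by
  have hq := r.qHat_nonneg i
  have hf := r.fHat_nonneg i
  rw [qAdj]
  positivity

theorem qAdj_le (i : ℕ) : r.qAdj i ≤ r.qHat i := by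
  have hq := r.qHat_nonneg i
  have hf := r.fHat_nonneg i
  rw [qAdj]
  exact div_le_self hq (by linarith [div_nonneg hf hq])

theorem P_mul_sum_qHat_le (l : ℕ) :
    r.code.P * ∑ i ∈ Finset.Icc 1 l, r.qHat i ≤ r.code.P := by
  have h : ∑ i ∈ Finset.Icc 1 l, r.code.P * r.qHat i =
      ∑ j ∈ (Finset.Icc 1 l).biUnion fun i => r.code.sent ∩ r.dec i, r.code.powerAt j := by
    rw [Finset.sum_biUnion]
    · refine Finset.sum_congr rfl fun i _ => ?_
      rw [qHat, Finset.mul_sum]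
      exact Finset.sum_congr rfl fun j _ => r.code.P_mul_π j
    · intro i hi j hj hij
      exact (r.disjoint_dec (Finset.mem_Icc.1 hi).1 (Finset.mem_Icc.1 hj).1 hij).mono
        Finset.inter_subset_right Finset.inter_subset_right
  have h2 : r.code.P = ∑ j ∈ r.code.sent, r.code.powerAt j := by
    rw [r.code.sum_sent]
    rfl
  rw [Finset.mul_sum, h]
  conv_rhs => rw [h2]
  refine Finset.sum_le_sum_of_subset_of_nonneg ?_ fun j _ _ => (r.code.powerAt_pos j).le
  exact Finset.biUnion_subset.2 fun i _ => Finset.inter_subset_left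

theorem one_sub_pos (l : ℕ) : 0 < 1 - r.qAdjTot l * r.code.ν := by
  have h1 : r.code.P * r.qAdjTot l ≤ r.code.P :=
    (mul_le_mul_of_nonneg_left (Finset.sum_le_sum fun i _ => r.qAdj_le i)
      r.code.P_nonneg).trans (r.P_mul_sum_qHat_le l)
  have h2 : (0 : ℝ) < r.code.σ := r.code.σ_pos
  have h3 := r.code.P_add_mul_ν
  have h4 := r.code.P_add_pos
  refine pos_of_mul_pos_right (a := r.code.P + (r.code.σ : ℝ) ^ 2) ?_ h4.le
  have h5 : (r.code.P + (r.code.σ : ℝ) ^ 2) * (1 - r.qAdjTot l * r.code.ν) =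
      r.code.P + (r.code.σ : ℝ) ^ 2 - r.code.P * r.qAdjTot l := by
    linear_combination (-r.qAdjTot l) * h3
  rw [h5]
  have : 0 < (r.code.σ : ℝ) ^ 2 := by positivity
  linarith

theorem sHat_pos (l : ℕ) : 0 < r.sHat l := one_div_pos.2 (r.one_sub_pos _)

theorem sHat_mul (l : ℕ) : r.sHat l * (1 - r.qAdjTot (l - 1) * r.code.ν) = 1 := by
  rw [sHat, one_div_mul_cancel (r.one_sub_pos _).ne']

theorem sHat_one : r.sHat 1 = 1 := by simp [sHat, qAdjTot]

theorem qAdjTot_sub_one {k : ℕ} (hk : 2 ≤ k) :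
    r.qAdjTot (k - 1) = r.qAdjTot (k - 1 - 1) + r.qAdj (k - 1) := by
  obtain ⟨m, rfl⟩ : ∃ m, k = m + 2 := ⟨k - 2, by omega⟩
  simp only [qAdjTot]
  exact Finset.sum_Icc_succ_top (by omega) _

theorem wHat_eq {k : ℕ} (hk : 2 ≤ k) : r.wHat k = r.sHat k - r.sHat (k - 1) := by
  rw [wHat, if_neg (by omega)]

theorem wHat_eq_mul {k : ℕ} (hk : 2 ≤ k) :
    r.wHat k = r.sHat k * r.sHat (k - 1) * (r.code.ν * r.qAdj (k - 1)) := by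
  have h1 := r.sHat_mul k
  have h2 := r.sHat_mul (k - 1)
  rw [r.qAdjTot_sub_one hk] at h1
  rw [r.wHat_eq hk]
  linear_combination r.sHat (k - 1) * h1 - r.sHat k * h2

theorem wHat_nonneg {k : ℕ} (hk : 2 ≤ k) : 0 ≤ r.wHat k := by
  rw [r.wHat_eq_mul hk]
  have h1 := (r.sHat_pos k).le
  have h2 := (r.sHat_pos (k - 1)).le
  have h3 := r.code.ν_nonneg
  have h4 := r.qAdj_nonneg (k - 1)
  positivity

theorem sum_wHat {k : ℕ} (hk : 1 ≤ k) : ∑ i ∈ Finset.Icc 1 k, r.wHat i = r.sHat k := by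
  induction k, hk using Nat.le_induction with
  | base => simp [wHat]
  | succ k hk ih =>
    rw [Finset.sum_Icc_succ_top (by omega), ih, r.wHat_eq (by omega)]
    simp

theorem sHat_div {k : ℕ} (hk : 2 ≤ k) :
    r.sHat (k - 1) / r.sHat k = 1 - r.sHat (k - 1) * (r.code.ν * r.qAdj (k - 1)) := by
  have h := r.wHat_eq_mul hk
  rw [r.wHat_eq hk] at h
  rw [div_eq_iff (r.sHat_pos k).ne']
  linear_combination -h

theorem qHat_add_fHat_pos {i : ℕ} (h : (r.dec i).Nonempty) : 0 < r.qHat i + r.fHat i := by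
  rw [qHat_add_fHat]
  exact Finset.sum_pos (fun j _ => r.code.π_pos j) h

theorem σSq_pos {k : ℕ} (hk : 2 ≤ k) (h : r.Reached k) : 0 < r.σSq k := by
  have hne := h (k - 1) (Finset.mem_Ico.2 ⟨by omega, by omega⟩)
  obtain ⟨j, _⟩ := id hne
  exact mul_pos (mul_pos (r.code.P_pos j) (r.qHat_add_fHat_pos hne))
    (div_pos (r.sHat_pos _) (r.sHat_pos _))

/-! ### The residuals of the coefficients of a run -/

/-- The vectors of coefficients of `Y, -F_1, -F_2, …`. -/
def coef : ℕ → EuclideanSpace ℝ (Option (Term L M)) := r.code.coef r.dec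

/-- The vectors `F_1, F_2, …` involve disjoint sets of columns. -/
theorem inner_coef {l : ℕ} : ∀ i ∈ Finset.Ico 1 l, ∀ j ∈ Finset.Ico 1 l, i ≠ j →
    (inner ℝ (r.coef i) (r.coef j) : ℝ) = 0 := by
  intro i hi j hj hij
  rw [Finset.mem_Ico] at hi hj
  exact Code.inner_coef_of_disjoint hi.1 hj.1 (r.disjoint_dec hi.1 hj.1 hij)

theorem inner_coef_zero {i : ℕ} (hi : 1 ≤ i) :
    (inner ℝ (r.coef i) (r.coef 0) : ℝ) = -(r.code.P * r.qHat i) := Code.inner_coef_zero hi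

theorem norm_coef_sq {i : ℕ} (hi : 1 ≤ i) :
    ‖r.coef i‖ ^ 2 = r.code.P * (r.qHat i + r.fHat i) := by
  rw [qHat_add_fHat]
  exact Code.norm_coef_sq hi

/-- The variance of the entries of the part of `Y` outside of the span of `F_1, …, F_{l-1}` is `(P +
σ²) / ŝ_l`: subtracting the component along `F_i` lowers it by `P q̂_i^adj`. -/
theorem norm_residual_coef_sq {l : ℕ} (hl : 1 ≤ l) :
    ‖residual r.coef l‖ ^ 2 = (r.code.P + (r.code.σ : ℝ) ^ 2) / r.sHat l := by
  rw [norm_residual_sq r.inner_coef]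
  have h0 : ‖r.coef 0‖ ^ 2 = r.code.P + (r.code.σ : ℝ) ^ 2 := Code.norm_coef_zero_sq
  have h1 : ∑ i ∈ Finset.Ico 1 l, (inner ℝ (r.coef i) (r.coef 0) : ℝ) ^ 2 / ‖r.coef i‖ ^ 2 =
      r.code.P * r.qAdjTot (l - 1) := by
    have hI : Finset.Ico 1 l = Finset.Icc 1 (l - 1) := by
      ext i
      simp only [Finset.mem_Ico, Finset.mem_Icc]
      omega
    rw [qAdjTot, Finset.mul_sum, hI]
    refine Finset.sum_congr rfl fun i hi => ?_
    have hi1 := (Finset.mem_Icc.1 hi).1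
    rw [r.inner_coef_zero hi1, r.norm_coef_sq hi1, neg_sq, mul_pow, ← r.qAdj_mul]
    by_cases h : (r.dec i).Nonempty
    · have h1 := (r.qHat_add_fHat_pos h).ne'
      obtain ⟨j, _⟩ := h
      have h2 := (r.code.P_pos j).ne'
      field_simp
    · rw [Finset.not_nonempty_iff_eq_empty] at h
      simp [qAdj, qHat, h]
  rw [h0, h1, sHat, div_div_eq_mul_div, div_one]
  linear_combination (r.qAdjTot (l - 1)) * r.code.P_add_mul_ν

theorem residual_coef_ne_zero {l : ℕ} (hl : 1 ≤ l) : residual r.coef l ≠ 0 := by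
  intro h
  have h1 := r.norm_residual_coef_sq hl
  rw [h] at h1
  have h2 := div_pos r.code.P_add_pos (r.sHat_pos l)
  rw [← h1] at h2
  simp at h2

theorem inner_column_coef {l i : ℕ} {j : Term L M} (hj : j ∈ r.J l) (hi : i ∈ Finset.Ico 1 l) :
    (inner ℝ (Code.column j) (r.coef i) : ℝ) = 0 := by
  rw [Code.inner_column, coef, Code.coef_some (Finset.mem_Ico.1 hi).1, if_neg]
  intro h
  exact (Finset.mem_sdiff.1 hj).2 (Finset.mem_biUnion.2 ⟨i, hi, h⟩)

theorem inner_column_coef_zero (j : Term L M) :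
    (inner ℝ (Code.column j) (r.coef 0) : ℝ) = r.code.β j := by
  rw [Code.inner_column]
  rfl

open Submodule

/-- The matrix `Σ_k` is the Gram matrix of the parts of the columns outside of the span of the
vectors that were orthogonalized. -/
theorem gram_eq_Sig {k : ℕ} (hk : 1 ≤ k) :
    Matrix.gram ℝ (fun j : r.J k =>
      (span ℝ (r.coef '' Set.Iio k))ᗮ.starProjection (Code.column (j : Term L M))) = r.Sig k := by
  have hpr (j : r.J k) := starProjection_orthogonal_eq_sub_residual hk r.inner_coef
    (r.residual_coef_ne_zero hk) (u := Code.column (j : Term L M))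
    fun i hi => r.inner_column_coef j.2 hi
  ext i j
  rw [Matrix.gram_apply, inner_starProjection_left_eq_right,
    starProjection_eq_self_iff.2 (starProjection_apply_mem _ _), hpr, inner_sub_right,
    real_inner_smul_right, inner_residual_of_forall fun t ht => r.inner_column_coef i.2 ht,
    inner_column_coef_zero, inner_column_coef_zero, r.norm_residual_coef_sq hk, Code.inner_column,
    Sig, Matrix.sub_apply, Matrix.smul_apply, Matrix.vecMulVec_apply, δ, δ]
  have h1 : (Code.column (j : Term L M) : EuclideanSpace ℝ _) (some (i : Term L M)) =
      (1 : Matrix (r.J k) (r.J k) ℝ) i j := by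
    simp only [Code.column, Matrix.one_apply, EuclideanSpace.single]
    by_cases h : i = j
    · simp [h]
    · have : (i : Term L M) ≠ j := fun h' => h (Subtype.ext h')
      simp [h, this]
  have h2 : √(r.νAt k) * √(r.νAt k) = r.sHat k * r.code.ν :=
    Real.mul_self_sqrt (mul_nonneg (r.sHat_pos k).le r.code.ν_nonneg)
  have h3 := r.code.P_pos (i : Term L M)
  have h4 := r.code.P_add_pos
  have h5 := r.sHat_pos k
  rw [h1]
  congr 1
  have h6 : r.code.ν = r.code.P / (r.code.P + (r.code.σ : ℝ) ^ 2) := rfl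
  rw [smul_eq_mul, show √(r.νAt k) * r.code.β i * (√(r.νAt k) * r.code.β j) =
    (√(r.νAt k) * √(r.νAt k)) * (r.code.β i * r.code.β j) by ring, h2, h6]
  field_simp

theorem posSemidef_Sig {k : ℕ} (hk : 1 ≤ k) : (r.Sig k).PosSemidef := by
  rw [← r.gram_eq_Sig hk]
  exact Matrix.posSemidef_gram ℝ _

/-- The part of the coefficients of `-F_{k-1}` that is orthogonal to the earlier ones. -/
def innovation (k : ℕ) : EuclideanSpace ℝ (Option (Term L M)) :=
  (span ℝ (r.coef '' Set.Iio (k - 1)))ᗮ.starProjection (r.coef (k - 1))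

theorem innovation_eq {k : ℕ} (hk : 2 ≤ k) :
    r.innovation k = r.coef (k - 1) + (r.code.P * r.qHat (k - 1) /
      ‖residual r.coef (k - 1)‖ ^ 2) • residual r.coef (k - 1) := by
  rw [innovation, starProjection_orthogonal_eq_sub_residual (by omega) r.inner_coef
    (r.residual_coef_ne_zero (by omega)), r.inner_coef_zero (by omega), neg_div, neg_smul,
    sub_neg_eq_add]
  intro i hi
  have hi' := Finset.mem_Ico.1 hi
  exact r.inner_coef (l := k) _ (Finset.mem_Ico.2 ⟨by omega, by omega⟩) _
    (Finset.mem_Ico.2 ⟨by omega, by omega⟩) (by omega)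

/-- The number `σ_k²` is the variance of the entries of the part of `-F_{k-1}` that is new, relative
to the earlier vectors. -/
theorem norm_innovation_sq {k : ℕ} (hk : 2 ≤ k) : ‖r.innovation k‖ ^ 2 = r.σSq k := by
  have h0 : (inner ℝ (r.coef (k - 1)) (residual r.coef (k - 1)) : ℝ) =
      -(r.code.P * r.qHat (k - 1)) := by
    rw [inner_residual_of_forall, r.inner_coef_zero (by omega)]
    intro i hi
    have hi' := Finset.mem_Ico.1 hi
    exact r.inner_coef (l := k) _ (Finset.mem_Ico.2 ⟨by omega, by omega⟩) _
      (Finset.mem_Ico.2 ⟨by omega, by omega⟩) (by omega)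
  have hres := r.norm_residual_coef_sq (l := k - 1) (by omega)
  have hpos : 0 < ‖residual r.coef (k - 1)‖ := norm_pos_iff.2 (r.residual_coef_ne_zero (by omega))
  have h1 : ‖r.innovation k‖ ^ 2 = r.code.P * (r.qHat (k - 1) + r.fHat (k - 1)) -
      (r.code.P * r.qHat (k - 1)) ^ 2 / ‖residual r.coef (k - 1)‖ ^ 2 := by
    rw [r.innovation_eq hk, norm_add_sq_real, real_inner_smul_right, h0, norm_smul, mul_pow,
      Real.norm_eq_abs, sq_abs, r.norm_coef_sq (by omega)]
    field_simp
    ring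
  rw [h1, hres, σSq, r.sHat_div hk, mul_pow, ← r.qAdj_mul]
  have h4 := r.code.P_add_pos
  have h5 := r.sHat_pos (k - 1)
  have h6 : r.code.ν = r.code.P / (r.code.P + (r.code.σ : ℝ) ^ 2) := rfl
  rw [h6]
  field_simp

theorem inner_column_innovation {k : ℕ} (hk : 2 ≤ k) {j : Term L M} (hj : j ∈ r.J k) :
    (inner ℝ (Code.column j) (r.innovation k) : ℝ) =
      r.code.ν * r.qHat (k - 1) * r.sHat (k - 1) * r.code.β j := by
  rw [r.innovation_eq hk, inner_add_right, real_inner_smul_right,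
    r.inner_column_coef hj (Finset.mem_Ico.2 ⟨by omega, by omega⟩), inner_residual_of_forall,
    inner_column_coef_zero, r.norm_residual_coef_sq (by omega)]
  · have h4 := r.code.P_add_pos
    have h5 := r.sHat_pos (k - 1)
    have h6 : r.code.ν = r.code.P / (r.code.P + (r.code.σ : ℝ) ^ 2) := rfl
    rw [h6]
    field_simp
    ring
  · intro i hi
    have hi' := Finset.mem_Ico.1 hi
    exact r.inner_column_coef hj (Finset.mem_Ico.2 ⟨hi'.1, by omega⟩)

/-- The shift of the statistics of the sent terms is the component along the innovation. -/
theorem shift_eq {k : ℕ} (hk : 2 ≤ k) (hn : 1 ≤ n) (h : r.Reached k) {j : Term L M}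
    (hj : j ∈ r.J k) :
    √(r.wHat k * r.code.C n j) * (r.chi k / √n) * (if j ∈ r.code.sent then 1 else 0) =
      (inner ℝ (Code.column j) (r.innovation k) : ℝ) / ‖r.innovation k‖ ^ 2 * ‖r.G k‖ := by
  rw [r.inner_column_innovation hk hj, r.norm_innovation_sq hk, Code.β]
  split_ifs with hs
  swap
  · simp
  have hσ := r.σSq_pos hk h
  have hn' : (0 : ℝ) < n := by exact_mod_cast hn
  have hs1 := r.sHat_pos (k - 1)
  have hs2 := r.sHat_pos k
  have hq := r.qHat_nonneg (k - 1)
  have hν := r.code.ν_nonneg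
  have hP := r.code.P_pos j
  have hpj := r.code.powerAt_pos j
  have hchi : r.chi k = ‖r.G k‖ / √(r.σSq k) := by
    rw [chi, Real.sqrt_div (sq_nonneg _), Real.sqrt_sq (norm_nonneg _)]
  have hsqrt : √(r.wHat k * r.code.C n j) =
      √n * (r.code.ν * r.qHat (k - 1) * r.sHat (k - 1) * √(r.code.powerAt j) / √(r.σSq k)) := by
    have hnn : 0 ≤ r.code.ν * r.qHat (k - 1) * r.sHat (k - 1) * √(r.code.powerAt j) /
      √(r.σSq k) := by positivity
    rw [← Real.sqrt_sq hnn, ← Real.sqrt_mul hn'.le]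
    congr 1
    rw [div_pow, mul_pow, Real.sq_sqrt hσ.le, Real.sq_sqrt hpj.le, r.wHat_eq_mul hk, Code.C]
    have hqf := r.qHat_add_fHat_pos (h (k - 1) (Finset.mem_Ico.2 ⟨by omega, by omega⟩))
    have e1 : r.code.π j = r.code.powerAt j / r.code.P := rfl
    rw [mul_pow, mul_pow, ← r.qAdj_mul, σSq, e1]
    field_simp
  rw [hsqrt, hchi, mul_one]
  have h1 : 0 < √(n : ℝ) := Real.sqrt_pos.2 hn'
  have h2 : 0 < √(r.σSq k) := Real.sqrt_pos.2 hσ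
  have h3 : r.σSq k = √(r.σSq k) ^ 2 := (Real.sq_sqrt hσ.le).symm
  conv_rhs => rw [h3]
  field_simp

/-! ### A run as a linear image of white noise -/

/-- The columns of the dictionary, and the noise normalized to variance one. -/
def columns : Option (Term L M) → Vec n := fun o => o.elim ((r.code.σ : ℝ)⁻¹ • r.ε) r.X

theorem mix_column (j : Term L M) : mix r.columns (Code.column j) = r.X j := by
  rw [mix_apply, Fintype.sum_option]
  simp [Code.column, EuclideanSpace.single, columns]

theorem mix_coef (d : ℕ → Finset (Term L M)) (i : ℕ) :
    mix r.columns (r.code.coef d i) = r.toOrthogonalize d i := by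
  rw [mix_apply, Fintype.sum_option]
  cases i with
  | zero =>
    have h2 : (r.code.σ : ℝ) ≠ 0 := by exact_mod_cast r.code.σ_pos.ne'
    simp only [Code.coef, Option.elim, columns, toOrthogonalize, Y]
    rw [smul_smul, mul_inv_cancel₀ h2, one_smul, add_comm]
  | succ i =>
    simp only [Code.coef, Option.elim, columns, toOrthogonalize]
    rw [zero_smul, zero_add, ← Finset.sum_neg_distrib,
      ← Finset.sum_subset (Finset.subset_univ (d (i + 1)))]
    · refine Finset.sum_congr rfl fun j hj => ?_
      rw [if_pos hj, neg_smul]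
    · intro j _ hj
      rw [if_neg hj, zero_smul]

end Trial

namespace Trial

variable {L M n : ℕ}

/-! ### Runs with a prescribed sequence of decoded sets -/

theorem before_congr {d e : ℕ → Finset (Term L M)} {k : ℕ} (h : ∀ i ∈ Finset.Ico 1 k, d i = e i) :
    before d k = before e k := Finset.biUnion_congr rfl h

section

variable (r : Trial L M n) {d e : ℕ → Finset (Term L M)} {k : ℕ}

theorem statOf_congr {i : ℕ} (hi : i ≤ k) (h : ∀ i ∈ Finset.Ico 1 k, d i = e i) :
    r.statOf d i = r.statOf e i := by
  funext j
  rw [statOf, statOf, r.GOf_congr fun l h1 h2 => h l (Finset.mem_Ico.2 ⟨h1, by omega⟩)]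

theorem combOf_congr (h : ∀ i ∈ Finset.Ico 1 k, d i = e i) : r.combOf d k = r.combOf e k := by
  funext j
  refine Finset.sum_congr rfl fun i hi => ?_
  rw [r.statOf_congr (Finset.mem_Icc.1 hi).2 h]

/-- The past of step `k`, if the sets `d` are decoded. -/
def pastOf (d : ℕ → Finset (Term L M)) (k : ℕ) : Fin (k - 1) → Vec n × (Term L M → ℝ) :=
  fun i => (r.GOf d (i + 1), r.statOf d (i + 1))

theorem past_eq (k : ℕ) : r.past k = r.pastOf r.dec k := rfl

theorem pastOf_congr (h : ∀ i ∈ Finset.Ico 1 k, d i = e i) : r.pastOf d k = r.pastOf e k := by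
  funext i
  have hi : (i : ℕ) + 1 ≤ k := by omega
  rw [pastOf, pastOf, r.statOf_congr hi h,
    r.GOf_congr fun l h1 h2 => h l (Finset.mem_Ico.2 ⟨h1, by omega⟩)]

end

end Trial

open Trial

variable {L M n : ℕ}

/-- The combined statistics of step `i < k` as a function of the past of step `k`. -/
def Decoder.combFrom (D : Decoder L M) (k i : ℕ) (p : Fin (k - 1) → Vec n × (Term L M → ℝ))
    (j : Term L M) : ℝ :=
  ∑ l ∈ Finset.Icc 1 i, D.weight l i * if h : l - 1 < k - 1 then (p ⟨l - 1, h⟩).2 j else 0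

theorem Decoder.measurable_combFrom (D : Decoder L M) (k i : ℕ) :
    Measurable (D.combFrom (n := n) k i) := by
  refine measurable_pi_lambda _ fun j => ?_
  unfold combFrom
  refine Finset.measurable_sum _ fun l _ => Measurable.const_mul ?_ _
  split_ifs with h
  · exact (measurable_pi_apply j).comp (measurable_snd.comp (measurable_pi_apply _))
  · exact measurable_const

theorem Trial.combFrom_pastOf (r : Trial L M n) (d : ℕ → Finset (Term L M)) {k i : ℕ}
    (hi : i ∈ Finset.Ico 1 k) : r.decoder.combFrom k i (r.pastOf d k) = r.combOf d i := by
  have hi' := Finset.mem_Ico.1 hi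
  funext j
  refine Finset.sum_congr rfl fun l hl => ?_
  have hl' := Finset.mem_Icc.1 hl
  rw [dif_pos (by omega)]
  simp only [pastOf]
  rw [Nat.sub_add_cancel hl'.1]

/-- The pasts of step `k` from which the decoder selects the sets `d i`, for `1 ≤ i < k`. -/
def Decoder.pastSet (D : Decoder L M) (n : ℕ) (d : ℕ → Finset (Term L M)) (k : ℕ) :
    Set (Fin (k - 1) → Vec n × (Term L M → ℝ)) :=
  {p | ∀ i ∈ Finset.Ico 1 k, D.select i (before d i) (D.combFrom k i p) = d i}

theorem Decoder.measurableSet_pastSet (D : Decoder L M) (d : ℕ → Finset (Term L M)) (k : ℕ) :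
    MeasurableSet (D.pastSet n d k) := by
  have h : D.pastSet n d k = ⋂ i ∈ Finset.Ico 1 k,
      D.combFrom k i ⁻¹' {z | D.select i (before d i) z = d i} := by
    ext p
    simp [pastSet]
  rw [h]
  exact Finset.measurableSet_biInter _ fun i _ =>
    D.measurable_combFrom k i (D.measurable_select i _ _)

namespace Trial

variable (r : Trial L M n) (d : ℕ → Finset (Term L M)) (k : ℕ)

/-- The past determines the sets decoded before step `k`. -/
theorem past_mem_pastSet_iff :
    r.past k ∈ r.decoder.pastSet n d k ↔ ∀ i ∈ Finset.Ico 1 k, r.dec i = d i := by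
  have h0 : r.past k ∈ r.decoder.pastSet n d k ↔
      ∀ i ∈ Finset.Ico 1 k, r.decoder.select i (before d i) (r.comb i) = d i :=
    forall₂_congr fun i hi => by rw [past_eq, r.combFrom_pastOf _ hi]; rfl
  rw [h0]
  constructor
  · intro h i
    induction i using Nat.strong_induction_on with
    | _ i ih =>
      intro hi
      have hi' := Finset.mem_Ico.1 hi
      have hb : before r.dec i = before d i := before_congr fun l hl => by
        have hl' := Finset.mem_Ico.1 hl
        exact ih l hl'.2 (Finset.mem_Ico.2 ⟨hl'.1, by omega⟩)
      rw [r.dec_eq i hi'.1, hb, h i hi]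
  · intro h i hi
    have hi' := Finset.mem_Ico.1 hi
    have hb : before r.dec i = before d i := before_congr fun l hl => by
      have hl' := Finset.mem_Ico.1 hl
      exact h l (Finset.mem_Ico.2 ⟨hl'.1, by omega⟩)
    rw [← hb, ← r.dec_eq i hi'.1, h i hi]

/-- The prescribed sets `d` are the decoded ones if and only if the decoder selects them when it is
given the statistics that belong to `d`. -/
theorem pastOf_mem_pastSet_iff :
    r.pastOf d k ∈ r.decoder.pastSet n d k ↔ ∀ i ∈ Finset.Ico 1 k, r.dec i = d i := by
  have h0 : r.pastOf d k ∈ r.decoder.pastSet n d k ↔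
      ∀ i ∈ Finset.Ico 1 k, r.decoder.select i (before d i) (r.combOf d i) = d i :=
    forall₂_congr fun i hi => by rw [r.combFrom_pastOf _ hi]
  constructor
  · intro h
    rw [h0] at h
    intro i
    induction i using Nat.strong_induction_on with
    | _ i ih =>
      intro hi
      have hi' := Finset.mem_Ico.1 hi
      have heq : ∀ l ∈ Finset.Ico 1 i, r.dec l = d l := fun l hl => by
        have hl' := Finset.mem_Ico.1 hl
        exact ih l hl'.2 (Finset.mem_Ico.2 ⟨hl'.1, by omega⟩)
      have hcomb : r.comb i = r.combOf d i := r.combOf_congr heq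
      rw [r.dec_eq i hi'.1, before_congr heq, hcomb, h i hi]
  · intro h
    rw [← r.pastOf_congr h]
    exact (r.past_mem_pastSet_iff d k).2 h

/-! ### Quantities that are determined by the decoded sets -/

section Congr

variable {r k} {s : Trial L M n} (hc : r.code = s.code)
  (h : ∀ i ∈ Finset.Ico 1 k, r.dec i = s.dec i)
include h

theorem J_congr : r.J k = s.J k := by rw [J, J, before_congr h]

theorem reached_congr : r.Reached k ↔ s.Reached k :=
  forall₂_congr fun i hi => by rw [h i hi]

include hc

theorem qHat_congr {i : ℕ} (hi : i ∈ Finset.Ico 1 k) : r.qHat i = s.qHat i := by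
  rw [qHat, qHat, hc, h i hi]

theorem fHat_congr {i : ℕ} (hi : i ∈ Finset.Ico 1 k) : r.fHat i = s.fHat i := by
  rw [fHat, fHat, hc, h i hi]

theorem sHat_congr {l : ℕ} (hl : l ≤ k) : r.sHat l = s.sHat l := by
  have : r.qAdjTot (l - 1) = s.qAdjTot (l - 1) := by
    refine Finset.sum_congr rfl fun i hi => ?_
    have hi' := Finset.mem_Icc.1 hi
    have hik : i ∈ Finset.Ico 1 k := Finset.mem_Ico.2 ⟨hi'.1, by omega⟩
    rw [qAdj, qAdj, qHat_congr hc h hik, fHat_congr hc h hik]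
  rw [sHat, sHat, this, hc]

theorem wHat_congr : r.wHat k = s.wHat k := by
  rw [wHat, wHat, sHat_congr hc h le_rfl, sHat_congr hc h (Nat.sub_le k 1)]
  simp only [sHat_one]

theorem σSq_congr (hk : 2 ≤ k) : r.σSq k = s.σSq k := by
  have hik : k - 1 ∈ Finset.Ico 1 k := Finset.mem_Ico.2 ⟨by omega, by omega⟩
  rw [σSq, σSq, sHat_congr hc h le_rfl, sHat_congr hc h (Nat.sub_le k 1), qHat_congr hc h hik,
    fHat_congr hc h hik, hc]

theorem coef_congr {i : ℕ} (hi : i < k) : r.coef i = s.coef i := by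
  rw [coef, coef, hc]
  cases i with
  | zero => rfl
  | succ i =>
    simp only [Code.coef]
    rw [h (i + 1) (Finset.mem_Ico.2 ⟨by omega, hi⟩)]

theorem innovation_congr (hk : 2 ≤ k) : r.innovation k = s.innovation k := by
  have : r.coef '' Set.Iio (k - 1) = s.coef '' Set.Iio (k - 1) :=
    Set.image_congr fun i hi => coef_congr hc h (by have := Set.mem_Iio.1 hi; omega)
  simp only [innovation, this, coef_congr hc h (i := k - 1) (by omega)]

end Congr

end Trial

/-! ### Random runs -/

section Random

variable {Ω : Type*} [MeasurableSpace Ω] {μ : Measure Ω} [IsProbabilityMeasure μ]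
  (c : Code L M) (D : Decoder L M)
  (X : Ω → Term L M → Vec n) (ε : Ω → Vec n)

/-- The run with random dictionary `X` and random noise `ε`. -/
abbrev run (ω : Ω) : Trial L M n := ⟨c, D, X ω, ε ω⟩

variable {c D X ε}

theorem measurable_columns_run (hXm : ∀ j i, Measurable fun ω => X ω j i)
    (hεm : ∀ i, Measurable fun ω => ε ω i) : Measurable fun ω => (run c D X ε ω).columns := by
  refine measurable_pi_lambda _ fun o => ?_
  have h : Measurable fun ω => ((run c D X ε ω).columns o : Vec n).ofLp := by
    refine measurable_pi_lambda _ fun i => ?_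
    cases o with
    | none => exact (show Measurable fun ω => (c.σ : ℝ)⁻¹ * ε ω i from (hεm i).const_mul _)
    | some j => exact hXm j i
  exact (WithLp.measurable_toLp 2 _).comp h

/-- The columns of the dictionary and the normalized noise form a matrix of white noise. -/
theorem isWhite_columns (hXm : ∀ j i, Measurable fun ω => X ω j i)
    (hεm : ∀ i, Measurable fun ω => ε ω i)
    (hX : ∀ j i, μ.map (fun ω => X ω j i) = gaussianReal 0 1)
    (hε : ∀ i, μ.map (fun ω => ε ω i) = gaussianReal 0 (c.σ ^ 2))
    (hindep : iIndepFun (Sum.elim (fun (p : Term L M × Fin n) (ω : Ω) => X ω p.1 p.2)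
      (fun (i : Fin n) (ω : Ω) => ε ω i)) μ) :
    IsWhite (fun ω => (run c D X ε ω).columns) μ where
  measurable := measurable_columns_run hXm hεm
  map_entries := by
    have hm := measurable_columns_run (c := c) (D := D) hXm hεm
    have hme (p : Option (Term L M) × Fin n) :
        Measurable fun ω => (run c D X ε ω).columns p.1 p.2 := by
      have := (measurable_pi_apply p.1).comp hm
      fun_prop
    set φ : Option (Term L M) × Fin n → (Term L M × Fin n) ⊕ Fin n := fun p =>
      p.1.elim (.inr p.2) fun j => .inl (j, p.2) with hφ
    have hinj : Function.Injective φ := by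
      rintro ⟨_ | j, i⟩ ⟨_ | j', i'⟩ h <;> simp_all
    set f : (Term L M × Fin n) ⊕ Fin n → ℝ → ℝ :=
      Sum.elim (fun _ => id) fun _ x => (c.σ : ℝ)⁻¹ * x with hf
    have hfm (t) : Measurable (f t) := by
      rcases t with t | t
      · exact measurable_id
      · exact measurable_const_mul _
    have h1 := (hindep.comp f hfm).precomp hinj
    have h2 : iIndepFun (fun (p : Option (Term L M) × Fin n) ω =>
        (run c D X ε ω).columns p.1 p.2) μ := by
      convert h1 using 1
      funext p ω
      rcases p with ⟨_ | j, i⟩ <;> rfl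
    have h3 := (iIndepFun_iff_map_fun_eq_pi_map fun p => (hme p).aemeasurable).1 h2
    have h4 (p : Option (Term L M) × Fin n) :
        μ.map (fun ω => (run c D X ε ω).columns p.1 p.2) = gaussianReal 0 1 := by
      rcases p with ⟨_ | j, i⟩
      · have : (fun ω => (run c D X ε ω).columns none i) =
            (fun x => (c.σ : ℝ)⁻¹ * x) ∘ fun ω => ε ω i := rfl
        rw [this, ← Measure.map_map (by fun_prop) (hεm i), hε, gaussianReal_map_const_mul, mul_zero]
        congr 1
        have hσ : (c.σ : ℝ) ≠ 0 := by exact_mod_cast c.σ_pos.ne'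
        ext
        push_cast
        field_simp
      · exact hX j i
    simp only [h4] at h3
    rw [← map_pi_eq_stdGaussian, ← h3, Measure.map_map (WithLp.measurable_toLp 2 _)
      (measurable_pi_lambda _ hme)]
    rfl

variable (hXm : ∀ j i, Measurable fun ω => X ω j i) (hεm : ∀ i, Measurable fun ω => ε ω i)
include hXm hεm

theorem measurable_GOf (d : ℕ → Finset (Term L M)) (k : ℕ) :
    Measurable fun ω => (run c D X ε ω).GOf d k := by
  cases k with
  | zero => exact measurable_const
  | succ k =>
    refine measurable_gramSchmidt (fun i => ?_) k
    simp only [← Trial.mix_coef]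
    exact measurable_mix (measurable_columns_run hXm hεm) (c.coef d i)

theorem measurable_statOf (d : ℕ → Finset (Term L M)) (k : ℕ) :
    Measurable fun ω => (run c D X ε ω).statOf d k := by
  refine measurable_pi_lambda _ fun j => ?_
  have h1 := measurable_GOf (c := c) (D := D) hXm hεm d k
  have h2 : Measurable fun ω => (run c D X ε ω).X j :=
    (measurable_pi_apply (some j)).comp (measurable_columns_run (c := c) (D := D) hXm hεm)
  exact (h2.inner h1).div h1.norm

theorem measurable_pastOf (d : ℕ → Finset (Term L M)) (k : ℕ) :
    Measurable fun ω => (run c D X ε ω).pastOf d k :=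
  measurable_pi_lambda _ fun _ =>
    (measurable_GOf hXm hεm d _).prodMk (measurable_statOf hXm hεm d _)

/-- A function of the run is measurable if it is measurable where the sets that were decoded before
step `k` are given. -/
theorem measurable_of_dec {α : Type*} [MeasurableSpace α] (k : ℕ) {f : Ω → α}
    (h : ∀ ω₀, ∃ g : Ω → α, Measurable g ∧ ∀ ω,
      (∀ i ∈ Finset.Ico 1 k, (run c D X ε ω).dec i = (run c D X ε ω₀).dec i) → f ω = g ω) :
    Measurable f := by
  choose g hg hfg using h
  intro B hB
  -- the run `ω₀` is a representative of the runs with the same decoded sets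
  set E : Ω → Fin k → Finset (Term L M) := fun ω i => (run c D X ε ω).dec i with hE
  have hEd {ω ω₀ : Ω} : E ω = E ω₀ ↔
      ∀ i ∈ Finset.Ico 1 k, (run c D X ε ω).dec i = (run c D X ε ω₀).dec i := by
    constructor
    · intro h i hi
      exact congrFun h ⟨i, (Finset.mem_Ico.1 hi).2⟩
    · intro h
      funext i
      by_cases h0 : (i : ℕ) = 0
      · simp only [hE, h0]
        rfl
      · exact h i (Finset.mem_Ico.2 ⟨by omega, i.2⟩)
  have hset : f ⁻¹' B = ⋃ d ∈ Set.range E, {ω | E ω = d} ∩ f ⁻¹' B := by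
    ext ω
    simp
  rw [hset]
  refine MeasurableSet.biUnion (Set.to_countable _) ?_
  rintro _ ⟨ω₀, rfl⟩
  have h1 : {ω | E ω = E ω₀} = (fun ω => (run c D X ε ω).pastOf (run c D X ε ω₀).dec k) ⁻¹'
      D.pastSet n (run c D X ε ω₀).dec k := by
    ext ω
    exact hEd.trans ((run c D X ε ω).pastOf_mem_pastSet_iff _ k).symm
  have h2 : {ω | E ω = E ω₀} ∩ f ⁻¹' B = {ω | E ω = E ω₀} ∩ g ω₀ ⁻¹' B := by
    ext ω
    refine and_congr_right fun hω => ?_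
    rw [Set.mem_preimage, Set.mem_preimage, hfg ω₀ ω (hEd.1 hω)]
  rw [h2, h1]
  exact (measurable_pastOf hXm hεm _ k (D.measurableSet_pastSet _ k)).inter (hg ω₀ hB)

theorem measurable_past (k : ℕ) : Measurable fun ω => (run c D X ε ω).past k :=
  measurable_of_dec hXm hεm k fun ω₀ =>
    ⟨_, measurable_pastOf hXm hεm (run c D X ε ω₀).dec k, fun _ h => pastOf_congr _ h⟩

theorem measurable_G (k : ℕ) : Measurable fun ω => (run c D X ε ω).G k :=
  measurable_of_dec hXm hεm k fun ω₀ =>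
    ⟨_, measurable_GOf hXm hεm (run c D X ε ω₀).dec k, fun _ h =>
      Trial.GOf_congr _ fun l h1 h2 => h l (Finset.mem_Ico.2 ⟨h1, h2⟩)⟩

theorem measurable_stat (k : ℕ) : Measurable fun ω => (run c D X ε ω).stat k :=
  measurable_of_dec hXm hεm k fun ω₀ =>
    ⟨_, measurable_statOf hXm hεm (run c D X ε ω₀).dec k, fun _ h =>
      Trial.statOf_congr _ le_rfl h⟩

theorem measurable_chi {k : ℕ} (hk : 2 ≤ k) : Measurable fun ω => (run c D X ε ω).chi k := by
  have : Measurable fun ω => (run c D X ε ω).σSq k :=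
    measurable_of_dec hXm hεm k fun _ =>
      ⟨_, measurable_const, fun _ h => Trial.σSq_congr rfl h hk⟩
  exact (((measurable_G hXm hεm k).norm.pow_const 2).div this).sqrt

theorem measurable_wHat (k : ℕ) : Measurable fun ω => (run c D X ε ω).wHat k :=
  measurable_of_dec hXm hεm k fun _ => ⟨_, measurable_const, fun _ h => Trial.wHat_congr rfl h⟩

end Random

variable {Ω : Type*} {c : Code L M} {D : Decoder L M} {X : Ω → Term L M → Vec n} {ε : Ω → Vec n}

/-! ### The conditional distribution -/

/-- The sets decoded before step `k` are functions of the past of step `k`. -/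
theorem measurableSet_dec_eq (k : ℕ) {i : ℕ} (hi : i ∈ Finset.Ico 1 k) (S : Finset (Term L M)) :
    MeasurableSet[MeasurableSpace.comap (fun ω => (run c D X ε ω).past k) inferInstance]
      {ω | (run c D X ε ω).dec i = S} := by
  -- a sequence of sets on `{1, …, k - 1}`, extended by the empty set
  set extend : (Fin k → Finset (Term L M)) → ℕ → Finset (Term L M) := fun d i =>
    if h : i < k then d ⟨i, h⟩ else ∅ with hextend
  have hset : {ω | (run c D X ε ω).dec i = S} =
      ⋃ d ∈ {d : Fin k → Finset (Term L M) | extend d i = S},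
        (fun ω => (run c D X ε ω).past k) ⁻¹' D.pastSet n (extend d) k := by
    ext ω
    simp only [Set.mem_ofPred_eq, Set.mem_iUnion, Set.mem_preimage, exists_prop]
    have h1 (d) : (run c D X ε ω).past k ∈ D.pastSet n d k ↔ _ :=
      (run c D X ε ω).past_mem_pastSet_iff d k
    simp only [h1]
    constructor
    · intro h
      refine ⟨fun l => (run c D X ε ω).dec l, ?_, fun l hl => ?_⟩
      · simpa [hextend, (Finset.mem_Ico.1 hi).2] using h
      · simp [hextend, (Finset.mem_Ico.1 hl).2]
    · rintro ⟨d, hd, h⟩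
      rw [h i hi, hd]
  rw [hset]
  exact MeasurableSet.biUnion (Set.to_countable _) fun d _ =>
    ⟨_, D.measurableSet_pastSet (extend d) k, rfl⟩

variable [MeasurableSpace Ω] {μ : Measure Ω} [IsProbabilityMeasure μ]

/-- The matrix `Σ_k`, for the set `S` in place of `J_k`, and `s` in place of `ŝ_k`. -/
def sigOf (c : Code L M) (S : Finset (Term L M)) (s : ℝ) : Matrix S S ℝ :=
  1 - (1 / c.P) • Matrix.vecMulVec (fun j : S => √(s * c.ν) * c.β j)
    (fun j : S => √(s * c.ν) * c.β j)

/-- The variables `Z_{k,j}`: the statistics, without the shift of the sent terms. -/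
def noiseStat (r : Trial L M n) (k : ℕ) (j : Term L M) : ℝ :=
  r.stat k j - √(r.wHat k * r.code.C n j) * (r.chi k / √n) * (if j ∈ r.code.sent then 1 else 0)

variable (hXm : ∀ j i, Measurable fun ω => X ω j i) (hεm : ∀ i, Measurable fun ω => ε ω i)
include hXm hεm

theorem measurable_noiseStat {k : ℕ} (hk : 2 ≤ k) :
    Measurable fun ω => noiseStat (run c D X ε ω) k := by
  refine measurable_pi_lambda _ fun j => ?_
  have h1 : Measurable fun ω => (run c D X ε ω).stat k j :=
    (measurable_pi_apply j).comp (measurable_stat hXm hεm k)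
  have h2 := measurable_chi (c := c) (D := D) hXm hεm hk
  have h3 := measurable_wHat (c := c) (D := D) hXm hεm k
  change Measurable fun ω => (run c D X ε ω).stat k j - √((run c D X ε ω).wHat k * c.C n j) *
    ((run c D X ε ω).chi k / √n) * (if j ∈ c.sent then 1 else 0)
  fun_prop

/-- The conditional distribution on the event that the decoded sets are those of the run `ω₀`. On
this event, the run agrees with the one in which these sets are prescribed, whose vectors `G_i` come
from a Gram–Schmidt process with constant coefficients. -/
theorem condDistrib_of_dec_eq
    (hW : IsWhite (fun ω => (run c D X ε ω).columns) μ) {k : ℕ} (hk : 2 ≤ k) (hkn : k ≤ n)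
    (ω₀ : Ω) (h₀ : (run c D X ε ω₀).Reached k) :
    ∀ᵐ ω ∂μ, (∀ i ∈ Finset.Ico 1 k, (run c D X ε ω).dec i = (run c D X ε ω₀).dec i) →
      condDistrib (fun ω' => ((run c D X ε ω').chi k ^ 2,
          subvector ((run c D X ε ω₀).J k) (noiseStat (run c D X ε ω') k)))
        (fun ω' => (run c D X ε ω').past k) μ ((run c D X ε ω).past k) =
        (chiSquare (n - k + 1)).prod (multivariateGaussian 0 ((run c D X ε ω₀).Sig k)) := by
  set r₀ := run c D X ε ω₀ with hr₀
  set d := r₀.dec with hd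
  have hind : LinearIndepOn ℝ r₀.coef (Set.Iic (k - 1)) := by
    refine Code.linearIndepOn_coef (fun i hi j hj hij => ?_) fun i hi => ?_
    · exact r₀.disjoint_dec (Finset.mem_Icc.1 hi).1 (Finset.mem_Icc.1 hj).1 hij
    · have hi' := Finset.mem_Icc.1 hi
      exact h₀ i (Finset.mem_Ico.2 ⟨hi'.1, by omega⟩)
  have hIic : Set.Iic (k - 1) = Set.Iio k := by
    ext i
    simp only [Set.mem_Iic, Set.mem_Iio]
    omega
  obtain ⟨h1, h2⟩ := hW.step r₀.coef (k - 1) (by omega) hind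
    (fun j : Term L M => Code.column j) (fun j : r₀.J k => Code.column (j : Term L M))
    (e := r₀.innovation k) rfl (fun i ω => (run c D X ε ω).GOf d (i + 1)) (fun i ω => by
      have : (fun i => mix (run c D X ε ω).columns (r₀.coef i)) =
          (run c D X ε ω).toOrthogonalize d := by
        funext i
        exact (run c D X ε ω).mix_coef d i
      simp only [this]
      rfl)
  simp only [hIic, r₀.gram_eq_Sig (show 1 ≤ k by omega), mix_column] at h2
  rw [show n - (k - 1) = n - k + 1 by omega] at h2
  simp only [mix_column, Nat.sub_add_cancel (show 1 ≤ k by omega)] at h1 h2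
  have hpast : (fun ω => (run c D X ε ω).pastOf d k) = fun ω (i : Fin (k - 1)) =>
      ((run c D X ε ω).GOf d (i + 1), fun j => (inner ℝ ((run c D X ε ω).X j)
        ((run c D X ε ω).GOf d (i + 1)) : ℝ) / ‖(run c D X ε ω).GOf d (i + 1)‖) := rfl
  rw [← hpast] at h1
  rw [← h2]
  have hGm := measurable_GOf (c := c) (D := D) hXm hεm d k
  have hYm : Measurable fun ω => ((run c D X ε ω).chi k ^ 2,
      subvector (r₀.J k) (noiseStat (run c D X ε ω) k)) := by
    refine ((measurable_chi hXm hεm hk).pow_const 2).prodMk ?_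
    refine (WithLp.measurable_toLp 2 _).comp (measurable_pi_lambda _ fun j => ?_)
    exact (measurable_pi_apply (j : Term L M)).comp (measurable_noiseStat hXm hεm hk)
  have hmem (ω : Ω) := (run c D X ε ω).past_mem_pastSet_iff d k
  have hmem' (ω : Ω) := (run c D X ε ω).pastOf_mem_pastSet_iff d k
  have key := condDistrib_eq_of_indepFun_of_eqOn (measurable_past hXm hεm k) hYm ?_
    (D.measurableSet_pastSet d k) (fun ω => (hmem' ω).trans (hmem ω).symm)
    (fun ω hω => ((run c D X ε ω).pastOf_congr ((hmem ω).1 hω)).symm) (fun ω hω => ?_) h1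
  · filter_upwards [key] with ω hω h
    exact hω ((hmem ω).2 h)
  · refine ((hGm.norm.pow_const 2).div_const _).prodMk
      ((WithLp.measurable_toLp 2 _).comp (measurable_pi_lambda _ fun j => ?_))
    have hXj : Measurable fun ω => (run c D X ε ω).X (j : Term L M) :=
      (measurable_pi_apply (some (j : Term L M))).comp
        (measurable_columns_run (c := c) (D := D) hXm hεm)
    exact ((hXj.inner hGm).div hGm.norm).sub (hGm.norm.const_mul _)
  · have hdec := (hmem ω).1 hω
    have hR := (reached_congr hdec).2 h₀
    have hGG : (run c D X ε ω).GOf d k = (run c D X ε ω).G k :=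
      ((run c D X ε ω).GOf_congr fun l h1 h2 => hdec l (Finset.mem_Ico.2 ⟨h1, h2⟩)).symm
    have hinn : (run c D X ε ω).innovation k = r₀.innovation k := innovation_congr rfl hdec hk
    refine Prod.ext ?_ ?_
    · simp only
      rw [chi, Real.sq_sqrt (div_nonneg (sq_nonneg _) ((run c D X ε ω).σSq_pos hk hR).le), hGG,
        ← hinn, (run c D X ε ω).norm_innovation_sq hk]
    · ext j
      have hj : (j : Term L M) ∈ (run c D X ε ω).J k := by
        rw [J_congr hdec]
        exact j.2
      have hs := (run c D X ε ω).shift_eq hk (by omega) hR hj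
      simp only [subvector, noiseStat]
      rw [hs, hGG, hinn]
      rfl

/-- There are finitely many sequences of decoded sets, so the conditional distribution can be found
separately for each. -/
theorem condDistrib_of_reached
    (hW : IsWhite (fun ω => (run c D X ε ω).columns) μ) {k : ℕ} (hk : 2 ≤ k) (hkn : k ≤ n) :
    ∀ᵐ ω ∂μ, (run c D X ε ω).Reached k →
      condDistrib (fun ω' => ((run c D X ε ω').chi k ^ 2,
          subvector ((run c D X ε ω).J k) (noiseStat (run c D X ε ω') k)))
        (fun ω' => (run c D X ε ω').past k) μ ((run c D X ε ω).past k) =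
        (chiSquare (n - k + 1)).prod (multivariateGaussian 0 ((run c D X ε ω).Sig k)) := by
  have hall : ∀ d : Fin k → Finset (Term L M), ∀ᵐ ω ∂μ,
      (fun i : Fin k => (run c D X ε ω).dec i) = d → (run c D X ε ω).Reached k →
      condDistrib (fun ω' => ((run c D X ε ω').chi k ^ 2,
          subvector ((run c D X ε ω).J k) (noiseStat (run c D X ε ω') k)))
        (fun ω' => (run c D X ε ω').past k) μ ((run c D X ε ω).past k) =
        (chiSquare (n - k + 1)).prod (multivariateGaussian 0 ((run c D X ε ω).Sig k)) := by
    intro d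
    by_cases hd : ∃ ω₀, (fun i : Fin k => (run c D X ε ω₀).dec i) = d ∧ (run c D X ε ω₀).Reached k
    swap
    · exact Filter.Eventually.of_forall fun ω h1 h2 => absurd ⟨ω, h1, h2⟩ hd
    obtain ⟨ω₀, rfl, h₀⟩ := hd
    filter_upwards [condDistrib_of_dec_eq hXm hεm hW hk hkn ω₀ h₀] with ω hω h _
    have hdec : ∀ i ∈ Finset.Ico 1 k, (run c D X ε ω).dec i = (run c D X ε ω₀).dec i :=
      fun i hi => congrFun h ⟨i, (Finset.mem_Ico.1 hi).2⟩
    -- the set `J_k` occurs in types, so it is generalized before it is replaced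
    have hgen : ∀ (S : Finset (Term L M)) (s : ℝ), S = (run c D X ε ω₀).J k →
        s = (run c D X ε ω₀).sHat k →
        condDistrib (fun ω' => ((run c D X ε ω').chi k ^ 2,
            subvector S (noiseStat (run c D X ε ω') k)))
          (fun ω' => (run c D X ε ω').past k) μ ((run c D X ε ω).past k) =
        (chiSquare (n - k + 1)).prod (multivariateGaussian 0 (sigOf c S s)) := by
      rintro S s rfl rfl
      exact hω hdec
    exact hgen _ _ (J_congr hdec)
      (sHat_congr (r := run c D X ε ω) (s := run c D X ε ω₀) rfl hdec le_rfl)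
  filter_upwards [ae_all_iff.2 hall] with ω hω
  exact hω _ rfl

end SparseSuperposition

end

theorem lemma2 {Ω : Type*} [MeasurableSpace Ω] (μ : Measure Ω) [IsProbabilityMeasure μ]
    {L M n : ℕ} (c : Code L M) (D : Decoder L M)
    (X : Ω → Term L M → Vec n) (ε : Ω → Vec n)
    (hXm : ∀ j i, Measurable fun ω => X ω j i) (hεm : ∀ i, Measurable fun ω => ε ω i)
    -- the entries of `X` are standard normal, those of `ε` are `N(0, σ²)`, all independent
    (hX : ∀ j i, μ.map (fun ω => X ω j i) = gaussianReal 0 1)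
    (hε : ∀ i, μ.map (fun ω => ε ω i) = gaussianReal 0 (c.σ ^ 2))
    (hindep : iIndepFun (Sum.elim (fun (p : Term L M × Fin n) (ω : Ω) => X ω p.1 p.2)
      (fun (i : Fin n) (ω : Ω) => ε ω i)) μ)
    (r : Ω → Trial L M n) (hr : ∀ ω, r ω = ⟨c, D, X ω, ε ω⟩)
    (k : ℕ) (hk : 2 ≤ k) (hkn : k ≤ n) :
    -- the sets decoded before step `k` are determined by the past
    (∀ i ∈ Finset.Ico 1 k, ∀ S : Finset (Term L M),
      MeasurableSet[MeasurableSpace.comap (fun ω => (r ω).past k) inferInstance]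
        {ω | (r ω).dec i = S}) ∧
    -- the series `ŝ` and its increments `ŵ`
    (∀ ω, (r ω).wHat 1 = 1 ∧ (r ω).sHat 1 = 1 ∧
      (r ω).wHat k = (r ω).sHat k - (r ω).sHat (k - 1) ∧ 0 ≤ (r ω).wHat k ∧
      0 < 1 - (r ω).qAdjTot (k - 1) * c.ν ∧
      ∑ i ∈ Finset.Icc 1 k, (r ω).wHat i = (r ω).sHat k ∧
      (r ω).sHat k = 1 / (1 - (r ω).qAdjTot (k - 1) * c.ν)) ∧
    -- `Σ_k` is a covariance matrix, and `σ_k²` is positive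
    (∀ ω, ((r ω).Sig k).PosSemidef ∧ ((r ω).Reached k → 0 < (r ω).σSq k)) ∧
    -- the representation of the statistics
    ∃ Z : Ω → Term L M → ℝ, Measurable Z ∧
      (∀ ω, (r ω).Reached k → ∀ j ∈ (r ω).J k,
        (r ω).stat k j =
          √((r ω).wHat k * c.C n j) * ((r ω).chi k / √n) * (if j ∈ c.sent then 1 else 0)
            + Z ω j) ∧
      -- given the past, `𝒳²` is chi-square, `Z_{J_k}` is normal, and they are independent
      (∀ᵐ ω ∂μ, (r ω).Reached k →
        condDistrib (fun ω' => ((r ω').chi k ^ 2, subvector ((r ω).J k) (Z ω')))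
            (fun ω' => (r ω').past k) μ ((r ω).past k) =
          (chiSquare (n - k + 1)).prod (multivariateGaussian 0 ((r ω).Sig k))) := by
  obtain rfl : r = run c D X ε := funext hr
  have hW := isWhite_columns (c := c) (D := D) hXm hεm hX hε hindep
  refine ⟨fun i hi S => measurableSet_dec_eq k hi S, fun ω => ⟨?_, Trial.sHat_one _,
      Trial.wHat_eq _ hk, Trial.wHat_nonneg _ hk, Trial.one_sub_pos _ _,
      Trial.sum_wHat _ (by omega), rfl⟩,
    fun ω => ⟨Trial.posSemidef_Sig _ (by omega), Trial.σSq_pos _ hk⟩,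
    fun ω => noiseStat (run c D X ε ω) k, measurable_noiseStat hXm hεm hk,
    fun ω _ j _ => ?_, condDistrib_of_reached hXm hεm hW hk hkn⟩
  · simp [Trial.wHat, Trial.sHat_one]
  · simp only [noiseStat]
    ring
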